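/- A lattice is a finitely generated free abelian group $L$ with a $\mathbb{Q}$-valued symmetric bilinear form $(v,w)\mapsto v\cdot w$; write $v^2=v\cdot v$. Let $L$ be a Lorentzian lattice of rank $n+1$, that is, of signature $(n,1)$ with $n\ge 1$. Let $H^n$ and $\partial H^n$ be the images in $P(L\otimes\mathbb{R})$ of the vectors of negative norm and of the nonzero vectors of norm $0$, respectively, and $\overline{H^n}=H^n\cup\partial H^n$. A root of $L$ is a vector $\alpha\in L$ with $\alpha^2>0$ and $\alpha\cdot L\subseteq\frac{\alpha^2}{2}\mathbb{Z}$ which is primitive (that is, $L/\langle\alpha\rangle$ is torsion-free). The Weyl group $W(L)$ is generated by the reflections $x\mapsto x-2(x\cdot\alpha)\alpha/\alpha^2$ in the roots $\alpha$. The mirror of such a reflection is its fixed-point set in $H^n$, and a Weyl chamber of $W(L)$ is the closure in $\overline{H^n}$ of a connected component of the complement in $H^n$ of all these mirrors. Let $C$ be a Weyl chamber of $W(L)$. An ordinary corner of $C$ is a point $k\in C\cap H^n$ such that the set of roots orthogonal to $k$ has rank $n$. An ideal corner of $C$ is a point $k\in C\cap\partial H^n$ such that every horosphere centered at $k$ (a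 subset of $H^n$) meets $C$ in a compact set. A corner is an ordinary corner or an ideal corner. An edge of $C$ is a one-dimensional face of $C$, including its ideal endpoints if it has any; it is a closed geodesic segment in $\overline{H^n}$. **Lemma (edges end at corners).** Suppose $k$ is a corner of $C$ and $e$ is an edge of $C$ incident to $k$ (that is, $k\in e$). Then $k$ is an endpoint of $e$, and the other end of $e$ is also a corner of $C$. -/

import Mathlib

namespace LorentzianLattice

open Module

/-- The quotient topology on real projective space. -/
instance projectiveTopology {V : Type*} [NormedAddCommGroup V] [NormedSpace ℝ V] :
    TopologicalSpace (Projectivization ℝ V) :=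
  inferInstanceAs (TopologicalSpace (Quotient (projectivizationSetoid ℝ V)))

section Form

variable {V : Type*} [NormedAddCommGroup V] [NormedSpace ℝ V]

/-- The symmetric bilinear form `B` has signature `(n, 1)` with `n ≥ 1`: the space `V` is the
orthogonal direct sum of an `n`-dimensional positive definite subspace and a `1`-dimensional
negative definite subspace. -/
def HasLorentzianSignature (B : LinearMap.BilinForm ℝ V) (n : ℕ) : Prop :=
  1 ≤ n ∧ B.IsSymm ∧ ∃ P N : Submodule ℝ V,
    IsCompl P N ∧ finrank ℝ P = n ∧ finrank ℝ N = 1 ∧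
    (∀ x ∈ P, ∀ y ∈ N, B x y = 0) ∧
    (∀ x ∈ P, x ≠ 0 → 0 < B x x) ∧ (∀ y ∈ N, y ≠ 0 → B y y < 0)

/-- `L`, a lattice in the real vector space `V = L ⊗ ℝ`, is a Lorentzian lattice of signature
`(n, 1)`: the form takes rational values on `L` and has that signature on `V`. -/
structure IsLorentzian (B : LinearMap.BilinForm ℝ V) (L : Submodule ℤ V) (n : ℕ) : Prop where
  rational : ∀ x ∈ L, ∀ y ∈ L, ∃ q : ℚ, B x y = q
  signature : HasLorentzianSignature B n

/-- Hyperbolic space `Hⁿ`: the image in projective space of the timelike vectors. -/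
def hyperbolicSpace (B : LinearMap.BilinForm ℝ V) : Set (Projectivization ℝ V) :=
  {p | B p.rep p.rep < 0}

/-- The boundary `∂Hⁿ`: the image in projective space of the lightlike vectors. -/
def idealBoundary (B : LinearMap.BilinForm ℝ V) : Set (Projectivization ℝ V) :=
  {p | B p.rep p.rep = 0}

/-- A nonzero element `α` of `L` (as all roots are) is primitive if `L / ⟨α⟩` is torsion-free. -/
def IsPrimitive (L : Submodule ℤ V) (α : V) : Prop :=
  ∀ v ∈ L, ∀ m : ℤ, m ≠ 0 → m • v ∈ Submodule.span ℤ {α} → v ∈ Submodule.span ℤ {α}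

/-- Roots of `L`: primitive lattice vectors `α` with `α² > 0` and `α · L ⊆ (α² / 2) ℤ`. -/
def rootSystem (B : LinearMap.BilinForm ℝ V) (L : Submodule ℤ V) : Set V :=
  {α | α ∈ L ∧ 0 < B α α ∧ (∀ v ∈ L, ∃ m : ℤ, B α v = B α α / 2 * m) ∧ IsPrimitive L α}

/-- The reflection `x ↦ x - 2 (x · α) α / α²`. The reflections in the roots of `L` are the
reflections which generate the Weyl group `W(L)`. -/
noncomputable def reflection (B : LinearMap.BilinForm ℝ V) (α : V) : V →ₗ[ℝ] V :=
  LinearMap.id - (2 / B α α) • (B α).smulRight α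

/-- The mirror of the reflection in `α`: its fixed-point set in `Hⁿ`, a point of `Hⁿ` being
fixed when the corresponding line in `V` is mapped to itself. -/
def mirror (B : LinearMap.BilinForm ℝ V) (α : V) : Set (Projectivization ℝ V) :=
  {p | p ∈ hyperbolicSpace B ∧ p.submodule.map (reflection B α) = p.submodule}

/-- What remains of `Hⁿ` after removing the mirrors of all reflections of `L`. -/
def mirrorComplement (B : LinearMap.BilinForm ℝ V) (L : Submodule ℤ V) :
    Set (Projectivization ℝ V) :=
  hyperbolicSpace B \ ⋃ α ∈ rootSystem B L, mirror B α

/-- A Weyl chamber of `W(L)`: the closure of a connected component of the complement of the mirrors.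
The closure is taken in projective space, where `Hⁿ ∪ ∂Hⁿ` is closed. -/
def IsWeylChamber (B : LinearMap.BilinForm ℝ V) (L : Submodule ℤ V)
    (C : Set (Projectivization ℝ V)) : Prop :=
  ∃ x ∈ mirrorComplement B L, C = closure (connectedComponentIn (mirrorComplement B L) x)

/-- The open geodesic between two points `x ≠ y` of `Hⁿ ∪ ∂Hⁿ`: the points represented by `u + v`,
where `u` and `v` represent `x` and `y` and lie in the same one of the two cones. -/
def openGeodesic (B : LinearMap.BilinForm ℝ V) (x y : Projectivization ℝ V) :
    Set (Projectivization ℝ V) :=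
  {p | ∃ u ∈ x.submodule, ∃ v ∈ y.submodule, B u v < 0 ∧ u + v ≠ 0 ∧ u + v ∈ p.submodule}

/-- The closed geodesic, with its end points, which may be ideal. -/
def closedGeodesic (B : LinearMap.BilinForm ℝ V) (x y : Projectivization ℝ V) :
    Set (Projectivization ℝ V) :=
  {x, y} ∪ openGeodesic B x y

/-- `e` is an edge of the convex set `C`, that is, a one-dimensional face, containing its end
points even if these are ideal: a nontrivial closed geodesic contained in `C` such that every
geodesic between two points of `C` whose interior meets `e` has both end points in `e`. -/
def IsEdge (B : LinearMap.BilinForm ℝ V) (C e : Set (Projectivization ℝ V)) : Prop :=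
  (∃ a b, a ≠ b ∧ e = closedGeodesic B a b) ∧ e ⊆ C ∧
    ∀ x ∈ C, ∀ y ∈ C, (openGeodesic B x y ∩ e).Nonempty → x ∈ e ∧ y ∈ e

/-- `k'` is the other end of the edge `e`, one of whose ends is `k`. -/
def IsOtherEnd (B : LinearMap.BilinForm ℝ V) (e : Set (Projectivization ℝ V))
    (k k' : Projectivization ℝ V) : Prop :=
  k' ≠ k ∧ e = closedGeodesic B k k'

/-- The horospheres centered at the ideal point `k` are these sets, for `c > 0`: the level sets on
`Hⁿ` of the function `(x · k)² / (-x²)`. -/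
def horosphere (B : LinearMap.BilinForm ℝ V) (k : Projectivization ℝ V) (c : ℝ) :
    Set (Projectivization ℝ V) :=
  {p | p ∈ hyperbolicSpace B ∧ B p.rep k.rep ^ 2 / (-B p.rep p.rep) = c}

/-- An ordinary corner of `C` is a point `k` of `C ∩ Hⁿ` such that the set of roots orthogonal
to `k` has rank `n`. -/
def IsOrdinaryCorner (B : LinearMap.BilinForm ℝ V) (L : Submodule ℤ V) (n : ℕ)
    (C : Set (Projectivization ℝ V)) (k : Projectivization ℝ V) : Prop :=
  k ∈ C ∧ k ∈ hyperbolicSpace B ∧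
    finrank ℝ (Submodule.span ℝ {α | α ∈ rootSystem B L ∧ B α k.rep = 0}) = n

/-- An ideal corner of `C` is a point `k` of `C ∩ ∂Hⁿ` such that every horosphere centered
at `k` meets `C` in a compact set. -/
def IsIdealCorner (B : LinearMap.BilinForm ℝ V)
    (C : Set (Projectivization ℝ V)) (k : Projectivization ℝ V) : Prop :=
  k ∈ C ∧ k ∈ idealBoundary B ∧ ∀ c : ℝ, 0 < c → IsCompact (horosphere B k c ∩ C)

/-- A corner is an ordinary corner or an ideal corner. -/
def IsCorner (B : LinearMap.BilinForm ℝ V) (L : Submodule ℤ V) (n : ℕ)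
    (C : Set (Projectivization ℝ V)) (k : Projectivization ℝ V) : Prop :=
  IsOrdinaryCorner B L n C k ∨ IsIdealCorner B C k

end Form

end LorentzianLattice

/-!
The chamber is lifted to a cone in `V`. No root changes sign on a component of the complement of the
mirrors, and the segment from an interior point to any point of the cone cut out by these signs
meets no mirror before its end, so `C` is the image of `chamberCone`
(`IsWeylChamber.exists_eq_chamber`).
The mirrors are locally finite (`eventually_forall_root_nonneg`), because coroots lie in the dual
lattice and have bounded norm; so near a timelike point the cone is cut out by the roots vanishing
there, and a direction killed by all of these roots stays inside every edge through that point
(`IsEdge.exists_add_smul`).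

Let the edge join the points represented by `u` and `v`. A point strictly between them is not a
corner, since roots vanishing there vanish on all of the edge. If `v` is timelike, local finiteness
shows that it is an ordinary corner. Now let `v` be null. The roots vanishing on the edge have the
plane of `u` and `v` as their common orthogonal complement, so this plane is rational, and a
multiple `K` of its bivector preserves `L`. On the plane `K² = D` with `D` an integer, and `v` is an
eigenvector of `K`.

* If `D` is a square, the line of `v` is rational. Transvections along `v` show that each mirror
  through the edge has parallel translates on both sides. They confine the chamber near `v`, which
  is therefore an ideal corner (`isIdealCorner_of_rational`).
* If `D` is not a square, a solution of Pell's equation gives an automorphism of `L` that translates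
  along the edge and fixes the roots vanishing on it (`exists_pell_isometry`). If `u` is an ordinary
  corner, the translation moves a mirror through `u` into the interior of the edge, which is absurd
  (`false_of_translation`). If `u` is an ideal corner, the translation preserves the chamber and
  carries the compactness of horospherical sections from `u` to `v`
  (`isIdealCorner_of_translation`).
-/

namespace LorentzianLattice

open Module Filter Topology

/-! ### Linear algebra of Lorentzian forms -/

section Lorentz

variable {V : Type*} [NormedAddCommGroup V] [NormedSpace ℝ V]

/-- The consequences of Lorentzian signature on which the geometry rests: there are timelike
vectors, and the form is positive definite on the orthogonal complement of each of them. -/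
structure IsMinkowski (B : LinearMap.BilinForm ℝ V) : Prop where
  symm : ∀ x y, B x y = B y x
  exists_timelike : ∃ e, B e e < 0
  pos_of_orthogonal : ∀ p x, B p p < 0 → B p x = 0 → x ≠ 0 → 0 < B x x

/-- If `x` is orthogonal to the timelike vector `p` and not spacelike, the plane of `p` and `x` is
negative semidefinite, which is impossible as it meets the positive summand of codimension one. -/
theorem HasLorentzianSignature.isMinkowski {B : LinearMap.BilinForm ℝ V} {n : ℕ}
    (h : HasLorentzianSignature B n) : IsMinkowski B := by
  obtain ⟨-, hs, P, N, hc, -, hN, hPN, hP, hNn⟩ := h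
  have symm : ∀ x y, B x y = B y x := fun x y => by simpa using hs.eq x y
  obtain ⟨⟨e, heN⟩, he0, he⟩ := finrank_eq_one_iff'.mp hN
  have he0' : e ≠ 0 := fun h => he0 (Subtype.ext h)
  have hee := hNn e heN he0'
  have key : ∀ x, B e x = 0 → x ∈ P := by
    intro x hx
    have hxt : x ∈ P ⊔ N := by rw [hc.sup_eq_top]; trivial
    obtain ⟨y, hy, z, hz, rfl⟩ := Submodule.mem_sup.mp hxt
    obtain ⟨c, hcz⟩ := he ⟨z, hz⟩
    have hcz' : c • e = z := congrArg Subtype.val hcz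
    have h1 : B e y = 0 := by rw [symm]; exact hPN y hy e heN
    rw [map_add, h1, ← hcz', map_smul, smul_eq_mul, zero_add] at hx
    rcases mul_eq_zero.mp hx with h | h
    · rw [← hcz', h, zero_smul, add_zero]; exact hy
    · exact absurd h hee.ne
  refine ⟨symm, ⟨e, hee⟩, fun p x hp hpx hx => ?_⟩
  by_contra! hxx
  have hep : B e p ≠ 0 := fun h => by
    have hpP := key p h
    by_cases hp0 : p = 0
    · simp [hp0] at hp
    · exact absurd (hP p hpP hp0) (not_lt.mpr hp.le)
  -- Subtract from `x` the multiple of `p` that brings it into the positive definite summand.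
  set c := B e x / B e p with hcdef
  have hw : x - c • p ∈ P := key _ (by simp [hcdef, hep])
  have hxp : B x p = 0 := by rw [symm]; exact hpx
  have hww : B (x - c • p) (x - c • p) = B x x + c ^ 2 * B p p := by
    simp [hpx, hxp]; ring
  by_cases h0 : x - c • p = 0
  · have hx' : x = c • p := sub_eq_zero.mp h0
    rw [hx', map_smul, smul_eq_mul] at hpx
    rcases mul_eq_zero.mp hpx with h | h
    · exact hx (by rw [hx', h, zero_smul])
    · exact hp.ne h
  · have := hP _ hw h0
    nlinarith [sq_nonneg c]

theorem HasLorentzianSignature.finrank_eq [FiniteDimensional ℝ V]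
    {B : LinearMap.BilinForm ℝ V} {n : ℕ} (h : HasLorentzianSignature B n) :
    finrank ℝ V = n + 1 := by
  obtain ⟨-, -, P, N, hc, hP, hN, -⟩ := h
  rw [← Submodule.finrank_add_eq_of_isCompl hc, hP, hN]

variable {B : LinearMap.BilinForm ℝ V}

theorem form_eq_zero_of_mem_span {A : Set V} {z : V} (h : ∀ α ∈ A, B α z = 0) {x : V}
    (hx : x ∈ Submodule.span ℝ A) : B x z = 0 := by
  induction hx using Submodule.span_induction with
  | mem x hx => exact h x hx
  | zero => simp
  | add x y _ _ hx hy => simp [hx, hy]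
  | smul c x _ hx => simp [hx]

namespace IsMinkowski

variable (hB : IsMinkowski B)
include hB

theorem eq_zero_of_forall {z : V} (h : ∀ x, B z x = 0) : z = 0 := by
  by_contra hz
  obtain ⟨e, he⟩ := hB.exists_timelike
  have := hB.pos_of_orthogonal e z he (by rw [hB.symm]; exact h e) hz
  exact this.ne' (h z)

theorem nondegenerate : B.Nondegenerate := by
  refine ⟨fun z hz => hB.eq_zero_of_forall hz, fun z hz => hB.eq_zero_of_forall fun x => ?_⟩
  rw [hB.symm]; exact hz x

/-- A nonzero causal vector is not orthogonal to a timelike one. -/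
theorem inner_ne_zero {p x : V} (hp : B p p < 0) (hx : B x x ≤ 0) (hx0 : x ≠ 0) : B p x ≠ 0 :=
  fun h => (hB.pos_of_orthogonal p x hp h hx0).not_ge hx

/-- The equality case of the reversed Cauchy-Schwarz inequality: future causal vectors with
nonnegative product are proportional. -/
theorem proportional_of_nonneg {p x y : V} (hp : B p p < 0) (hx : B x x ≤ 0) (hy : B y y ≤ 0)
    (hpx : B p x < 0) (hpy : B p y < 0) (hxy : 0 ≤ B x y) : B p y • x = B p x • y := by
  by_contra h
  have hne : B p y • x - B p x • y ≠ 0 := sub_ne_zero.mpr h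
  have := hB.pos_of_orthogonal p _ hp (by simp; ring) hne
  have e : B (B p y • x - B p x • y) (B p y • x - B p x • y)
      = (B p y) ^ 2 * B x x + (B p x) ^ 2 * B y y - 2 * (B p x * B p y) * B x y := by
    simp [hB.symm y x]; ring
  rw [e] at this
  nlinarith [mul_pos_of_neg_of_neg hpx hpy, sq_nonneg (B p y), sq_nonneg (B p x),
    mul_nonneg (mul_pos_of_neg_of_neg hpx hpy).le hxy]

theorem inner_nonpos {p x y : V} (hp : B p p < 0) (hx : B x x ≤ 0) (hy : B y y ≤ 0)
    (hpx : B p x < 0) (hpy : B p y < 0) : B x y ≤ 0 := by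
  by_contra! h
  have e := hB.proportional_of_nonneg hp hx hy hpx hpy h.le
  have e1 : B x (B p y • x) = B x (B p x • y) := by rw [e]
  simp only [map_smul, smul_eq_mul] at e1
  nlinarith [mul_nonneg_of_nonpos_of_nonpos hpy.le hx, mul_neg_of_neg_of_pos hpx h]

theorem inner_neg_of_timelike {p x y : V} (hp : B p p < 0) (hx : B x x < 0) (hy : B y y ≤ 0)
    (hpx : B p x < 0) (hpy : B p y < 0) : B x y < 0 := by
  by_contra! h
  have e := hB.proportional_of_nonneg hp hx.le hy hpx hpy h
  have e1 : B x (B p y • x) = B x (B p x • y) := by rw [e]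
  simp only [map_smul, smul_eq_mul] at e1
  nlinarith [mul_pos_of_neg_of_neg hpy hx, mul_nonpos_of_nonpos_of_nonneg hpx.le h]

end IsMinkowski

section FiniteDimensional

variable [FiniteDimensional ℝ V]

theorem continuous_form (B : LinearMap.BilinForm ℝ V) : Continuous fun x : V × V => B x.1 x.2 :=
  (LinearMap.toContinuousBilinearMap B).continuous₂

theorem continuous_form_self (B : LinearMap.BilinForm ℝ V) : Continuous fun x : V => B x x :=
  (continuous_form B).comp (continuous_id.prodMk continuous_id)

theorem continuous_inner (B : LinearMap.BilinForm ℝ V) (z : V) : Continuous fun x : V => B z x :=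
  (continuous_form B).comp (continuous_const.prodMk continuous_id)

namespace IsMinkowski

variable (hB : IsMinkowski B)
include hB

/-- Changing the sign of the form on the line of a timelike vector `p` gives a positive definite
form, which dominates a multiple of the squared norm. -/
theorem exists_pos_mul_norm_sq_le {p : V} (hp : B p p < 0) :
    ∃ m : ℝ, 0 < m ∧ ∀ x, m * ‖x‖ ^ 2 ≤ B x x + 2 * B p x ^ 2 / (-B p p) := by
  set Q : V → ℝ := fun x => B x x + 2 * B p x ^ 2 / (-B p p) with hQ
  have hQc : Continuous Q :=
    (continuous_form_self B).add ((continuous_const.mul ((continuous_inner B p).pow 2)).div_const _)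
  have hQpos : ∀ x, x ≠ 0 → 0 < Q x := by
    intro x hx
    set c := B p x / B p p with hc
    have hcp : c * B p p = B p x := div_mul_cancel₀ _ hp.ne
    have hort : B p (x - c • p) = 0 := by simp [hcp]
    have e1 : B (x - c • p) (x - c • p) = B x x - c ^ 2 * B p p := by
      simp [hB.symm x p, ← hcp]; ring
    have e2 : Q x = B x x - 2 * c ^ 2 * B p p := by
      simp only [hQ, ← hcp]; field_simp [hp.ne]; ring
    by_cases h0 : x - c • p = 0
    · have hc0 : c ≠ 0 := fun h => hx (by rw [sub_eq_zero.mp h0, h, zero_smul])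
      rw [h0] at e1
      simp only [map_zero] at e1
      nlinarith [mul_pos_of_neg_of_neg hp hp, mul_pos (sq_pos_of_ne_zero hc0) (neg_pos.mpr hp)]
    · have := hB.pos_of_orthogonal p _ hp hort h0
      nlinarith [sq_nonneg c, mul_nonneg (sq_nonneg c) (neg_pos.mpr hp).le]
  have hp0 : p ≠ 0 := fun h => by simp [h] at hp
  have : Nontrivial V := ⟨p, 0, hp0⟩
  obtain ⟨y, hy, hmin⟩ := (isCompact_sphere (0 : V) 1).exists_isMinOn
    (NormedSpace.sphere_nonempty.mpr zero_le_one) hQc.continuousOn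
  have hy1 : ‖y‖ = 1 := by simpa using hy
  have hy0 : y ≠ 0 := fun h => by simp [h] at hy1
  refine ⟨Q y, hQpos y hy0, fun x => ?_⟩
  change Q y * ‖x‖ ^ 2 ≤ Q x
  by_cases hx : x = 0
  · simp [hx, hQ]
  · have hn : ‖x‖ ≠ 0 := norm_ne_zero_iff.mpr hx
    have h1 : Q y ≤ Q (‖x‖⁻¹ • x) := hmin (by simp [norm_smul, hn])
    have h2 : Q (‖x‖⁻¹ • x) = Q x / ‖x‖ ^ 2 := by
      simp only [hQ, map_smul, LinearMap.smul_apply, smul_eq_mul]; field_simp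
    rw [h2, le_div_iff₀ (by positivity)] at h1
    exact h1

/-- Causal vectors, and more generally vectors of norm bounded above, are bounded as soon as
their product with a timelike vector is. -/
theorem exists_norm_le {p : V} (hp : B p p < 0) (a b : ℝ) :
    ∃ R, ∀ x, B x x ≤ a → |B p x| ≤ b → ‖x‖ ≤ R := by
  obtain ⟨m, hm, h⟩ := hB.exists_pos_mul_norm_sq_le hp
  refine ⟨Real.sqrt ((a + 2 * b ^ 2 / (-B p p)) / m), fun x hx hpx => Real.le_sqrt_of_sq_le ?_⟩
  rw [le_div_iff₀ hm, mul_comm]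
  refine (h x).trans (add_le_add hx ?_)
  have := neg_pos.mpr hp
  have : B p x ^ 2 ≤ b ^ 2 := sq_le_sq' (abs_le.mp hpx).1 (abs_le.mp hpx).2
  gcongr

theorem exists_norm_le_of_forall {S : Set V} (h : ∀ z, ∃ M, ∀ x ∈ S, |B z x| ≤ M) :
    ∃ R, ∀ x ∈ S, ‖x‖ ≤ R := by
  classical
  choose M hM using h
  let b := finBasis ℝ V
  let b' := LinearMap.BilinForm.dualBasis B hB.nondegenerate b
  refine ⟨∑ i, M (b i) * ‖b' i‖, fun x hx => ?_⟩
  rw [← b'.sum_repr x]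
  refine (norm_sum_le _ _).trans (Finset.sum_le_sum fun i _ => ?_)
  rw [norm_smul, LinearMap.BilinForm.dualBasis_repr_apply, hB.symm]
  exact mul_le_mul_of_nonneg_right (hM _ x hx) (norm_nonneg _)

/-- Rank `n` of a set orthogonal to `w`, restated: `w` spans its orthogonal complement. -/
theorem finrank_span_eq_iff {n : ℕ} (hn : finrank ℝ V = n + 1) {A : Set V} {w : V} (hw : w ≠ 0)
    (hA : ∀ α ∈ A, B α w = 0) :
    finrank ℝ (Submodule.span ℝ A) = n ↔
      ∀ z, (∀ α ∈ A, B α z = 0) → z ∈ Submodule.span ℝ {w} := by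
  have hmem : ∀ z, z ∈ B.orthogonal (Submodule.span ℝ A) ↔ ∀ α ∈ A, B α z = 0 := by
    intro z
    exact ⟨fun h α hα => h α (Submodule.subset_span hα),
      fun h x hx => form_eq_zero_of_mem_span h hx⟩
  have hle : Submodule.span ℝ {w} ≤ B.orthogonal (Submodule.span ℝ A) := by
    rw [Submodule.span_singleton_le_iff_mem]; exact (hmem w).mpr hA
  have h1 := finrank_span_singleton (K := ℝ) hw
  have h2 := LinearMap.BilinForm.finrank_orthogonal hB.nondegenerate (Submodule.span ℝ A)
  have h3 := (Submodule.span ℝ A).finrank_le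
  have h4 := Submodule.finrank_mono hle
  constructor
  · intro h z hz
    rw [Submodule.eq_of_le_of_finrank_eq hle (by omega)]
    exact (hmem z).mpr hz
  · intro h
    have : Submodule.span ℝ {w} = B.orthogonal (Submodule.span ℝ A) :=
      le_antisymm hle fun z hz => h z ((hmem z).mp hz)
    rw [← this] at h2
    omega

end IsMinkowski

end FiniteDimensional

end Lorentz

section Lattice

variable {V : Type*} [NormedAddCommGroup V] [NormedSpace ℝ V]
variable {B : LinearMap.BilinForm ℝ V} {L : Submodule ℤ V}

/-! ### Isometries and the root system -/

/-- The skew endomorphism `x ↦ (a · x) b - (b · x) a`, that is, the bivector `a ∧ b` viewed as an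
element of the orthogonal Lie algebra. -/
noncomputable def bivector (B : LinearMap.BilinForm ℝ V) (a b : V) : V →ₗ[ℝ] V :=
  (B a).smulRight b - (B b).smulRight a

theorem bivector_apply (a b x : V) : bivector B a b x = B a x • b - B b x • a := rfl

theorem bivector_skew (hs : ∀ x y, B x y = B y x) (a b x y : V) :
    B (bivector B a b x) y = -B x (bivector B a b y) := by
  simp only [bivector_apply, map_sub, map_smul, LinearMap.sub_apply, LinearMap.smul_apply,
    hs x a, hs x b, smul_eq_mul]
  ring

theorem bivector_bivector_bivector (hs : ∀ x y, B x y = B y x) (a b x : V) :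
    bivector B a b (bivector B a b (bivector B a b x)) =
      (B a b ^ 2 - B a a * B b b) • bivector B a b x := by
  simp only [bivector_apply, map_sub, map_smul, hs b a]
  module

/-- A quadratic polynomial in a skew endomorphism `K` with `K³ = D K` is an isometry as soon as its
coefficients satisfy `s² = 2 t + D t²`. Both the parabolic and the hyperbolic isometries used below
are of this form. -/
theorem exists_isometry {K : V →ₗ[ℝ] V} (hK : ∀ x y, B (K x) y = -B x (K y)) {D s t : ℝ}
    (hD : ∀ x, K (K (K x)) = D • K x) (hst : s ^ 2 = 2 * t + D * t ^ 2) :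
    ∃ g : V ≃ₗ[ℝ] V, (∀ x, g x = x + s • K x + t • K (K x)) ∧
      (∀ x, g.symm x = x - s • K x + t • K (K x)) ∧ ∀ x y, B (g x) (g y) = B x y := by
  have h1 : ∀ x, (x + s • K x + t • K (K x)) - s • K (x + s • K x + t • K (K x)) +
      t • K (K (x + s • K x + t • K (K x))) = x := by
    intro x
    simp only [map_add, map_smul, hD]
    rw [← sub_eq_zero]
    trans (2 * t + D * t ^ 2 - s ^ 2) • K (K x)
    · module
    · rw [hst, sub_self, zero_smul]
  have h2 : ∀ x, (x - s • K x + t • K (K x)) + s • K (x - s • K x + t • K (K x)) +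
      t • K (K (x - s • K x + t • K (K x))) = x := by
    intro x
    simp only [map_add, map_sub, map_smul, hD]
    rw [← sub_eq_zero]
    trans (2 * t + D * t ^ 2 - s ^ 2) • K (K x)
    · module
    · rw [hst, sub_self, zero_smul]
  let g : V ≃ₗ[ℝ] V := LinearEquiv.ofLinearMap
    (LinearMap.id + s • K + t • (K ∘ₗ K)) (LinearMap.id - s • K + t • (K ∘ₗ K))
    (LinearMap.ext h2) (LinearMap.ext h1)
  refine ⟨g, fun x => rfl, fun x => rfl, fun x y => ?_⟩
  have e : ∀ x z, B (g x) z = B x (g.symm z) := by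
    intro x z
    change B (x + s • K x + t • K (K x)) z = B x (z - s • K z + t • K (K z))
    simp only [map_add, map_sub, map_smul, LinearMap.add_apply, LinearMap.smul_apply, hK,
      smul_eq_mul]
    ring
  rw [e, LinearEquiv.symm_apply_apply]

/-- An automorphism of the lattice permutes its roots. -/
theorem map_mem_rootSystem {g : V ≃ₗ[ℝ] V} (hg : ∀ x y, B (g x) (g y) = B x y)
    (hL : ∀ x ∈ L, g x ∈ L) (hL' : ∀ x ∈ L, g.symm x ∈ L) {α : V} (hα : α ∈ rootSystem B L) :
    g α ∈ rootSystem B L := by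
  obtain ⟨h1, h2, h3, h4⟩ := hα
  refine ⟨hL α h1, by rwa [hg], fun v hv => ?_, fun v hv m hm hmv => ?_⟩
  · obtain ⟨m, hm⟩ := h3 _ (hL' v hv)
    exact ⟨m, by rw [hg, ← hm, ← hg α, LinearEquiv.apply_symm_apply]⟩
  · obtain ⟨c, hc⟩ := Submodule.mem_span_singleton.mp hmv
    obtain ⟨c', hc'⟩ := Submodule.mem_span_singleton.mp (h4 _ (hL' v hv) m hm
      (Submodule.mem_span_singleton.mpr ⟨c, by
        rw [← map_zsmul, ← hc, map_zsmul, LinearEquiv.symm_apply_apply]⟩))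
    exact Submodule.mem_span_singleton.mpr ⟨c', by
      rw [← map_zsmul, hc', LinearEquiv.apply_symm_apply]⟩

theorem neg_mem_rootSystem {α : V} (hα : α ∈ rootSystem B L) : -α ∈ rootSystem B L :=
  map_mem_rootSystem (g := LinearEquiv.neg ℝ) (fun x y => by simp) (fun x hx => by simpa using hx)
    (fun x hx => by simpa using hx) hα

/-! ### Integrality and local finiteness of the mirrors -/

variable [FiniteDimensional ℝ V] [DiscreteTopology L] [IsZLattice ℝ L]

theorem exists_common_denominator (hr : ∀ x ∈ L, ∀ y ∈ L, ∃ q : ℚ, B x y = q) :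
    ∃ q : ℤ, 0 < q ∧ ∀ x ∈ L, ∀ y ∈ L, ∃ m : ℤ, (q : ℝ) * B x y = m := by
  classical
  obtain ⟨s, hs⟩ := ZLattice.FG ℝ L
  have hsL : ∀ x ∈ s, x ∈ L := fun x hx => hs ▸ Submodule.subset_span hx
  choose! r hr using hr
  refine ⟨∏ p ∈ s ×ˢ s, ((r p.1 p.2).den : ℤ), Finset.prod_pos fun p _ => by
    exact_mod_cast (r p.1 p.2).den_pos, fun x hx y hy => ?_⟩
  rw [← hs] at hx hy
  induction hx, hy using Submodule.span_induction₂ with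
  | mem_mem x y hx hy =>
    obtain ⟨c, hc⟩ := Finset.dvd_prod_of_mem (fun p : V × V => ((r p.1 p.2).den : ℤ))
      (Finset.mk_mem_product hx hy)
    refine ⟨c * (r x y).num, ?_⟩
    rw [hc, hr x (hsL x hx) y (hsL y hy)]
    have : (((r x y).den : ℚ) : ℝ) * ((r x y : ℚ) : ℝ) = ((r x y).num : ℚ) := by
      rw [← Rat.cast_mul, Rat.den_mul_eq_num]
    push_cast at this ⊢
    linear_combination (c : ℝ) * this
  | zero_left y _ => exact ⟨0, by simp⟩
  | zero_right x _ => exact ⟨0, by simp⟩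
  | add_left x y z _ _ _ h1 h2 =>
    obtain ⟨a, ha⟩ := h1
    obtain ⟨b, hb⟩ := h2
    exact ⟨a + b, by rw [map_add, LinearMap.add_apply, mul_add, ha, hb]; push_cast; rfl⟩
  | add_right x y z _ _ _ h1 h2 =>
    obtain ⟨a, ha⟩ := h1
    obtain ⟨b, hb⟩ := h2
    exact ⟨a + b, by rw [map_add, mul_add, ha, hb]; push_cast; rfl⟩
  | smul_left c x y _ _ h1 =>
    obtain ⟨a, ha⟩ := h1
    refine ⟨c * a, ?_⟩
    rw [map_zsmul, LinearMap.smul_apply, zsmul_eq_mul]; push_cast; rw [← ha]; push_cast; ring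
  | smul_right c x y _ _ h1 =>
    obtain ⟨a, ha⟩ := h1
    refine ⟨c * a, ?_⟩
    rw [map_zsmul, zsmul_eq_mul]; push_cast; rw [← ha]; push_cast; ring

/-- The dual lattice has finitely many elements in each ball. -/
theorem finite_dual_inter_ball (hB : IsMinkowski B) (R : ℝ) :
    {β : V | (∀ l ∈ L, ∃ m : ℤ, B β l = m) ∧ ‖β‖ ≤ R}.Finite := by
  classical
  obtain ⟨s, hs⟩ := ZLattice.FG ℝ L
  have hsL : ∀ x ∈ s, x ∈ L := fun x hx => hs ▸ Submodule.subset_span hx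
  let f : V → (s → ℝ) := fun β i => B β i
  let c : s → ℝ := fun i => ‖LinearMap.toContinuousLinearMap (B (i : V))‖ * R
  refine Set.Finite.of_finite_image (f := f)
    ((Set.Finite.pi' (t := fun i : s => (Int.cast '' (Set.Icc (-⌈c i⌉) ⌈c i⌉) : Set ℝ))
      fun i => (Set.finite_Icc _ _).image _).subset ?_) ?_
  · rintro _ ⟨β, ⟨hβ, hR⟩, rfl⟩ i
    obtain ⟨m, hm⟩ := hβ i (hsL i i.2)
    have h1 : |(m : ℝ)| ≤ c i := by
      rw [← hm, hB.symm]
      exact ((LinearMap.toContinuousLinearMap (B (i : V))).le_opNorm β).trans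
        (mul_le_mul_of_nonneg_left hR (norm_nonneg _))
    have h2 := h1.trans (Int.le_ceil (c i))
    refine ⟨m, ?_, hm.symm⟩
    rw [Set.mem_Icc, ← abs_le]
    exact_mod_cast h2
  · intro x _ y _ hxy
    rw [← sub_eq_zero]
    refine hB.eq_zero_of_forall fun z => ?_
    have hz : z ∈ Submodule.span ℝ (L : Set V) := by
      rw [IsZLattice.span_top]; trivial
    rw [← hs, Submodule.span_span_of_tower] at hz
    induction hz using Submodule.span_induction with
    | mem z hz =>
      rw [map_sub, LinearMap.sub_apply, sub_eq_zero]
      exact congrFun hxy ⟨z, hz⟩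
    | zero => simp
    | add z w _ _ hz hw => rw [map_add, hz, hw, add_zero]
    | smul c z _ hz => rw [map_smul, hz, smul_zero]

omit [FiniteDimensional ℝ V] [DiscreteTopology L] [IsZLattice ℝ L] in
theorem one_le_mul_norm_of_mem_rootSystem {q : ℤ} (hq : 0 < q)
    (hint : ∀ x ∈ L, ∀ y ∈ L, ∃ m : ℤ, (q : ℝ) * B x y = m) {α : V} (hα : α ∈ rootSystem B L) :
    1 ≤ q * B α α := by
  obtain ⟨m, hm⟩ := hint α hα.1 α hα.1
  have h : (0 : ℝ) < q * B α α := mul_pos (by exact_mod_cast hq) hα.2.1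
  rw [hm] at h ⊢
  exact_mod_cast h

/-- Local finiteness of the mirrors, in the form needed below: near a timelike vector `v`, the
half-spaces of the roots positive at `v` impose no condition. The coroots `2 α / α²` lie in the
dual lattice and have bounded norm, so only finitely many of their mirrors come close to `v`. -/
theorem eventually_forall_root_nonneg (hB : IsMinkowski B)
    (hr : ∀ x ∈ L, ∀ y ∈ L, ∃ q : ℚ, B x y = q) {v : V} (hv : B v v < 0) (z : V) :
    ∀ᶠ ε in 𝓝 (0 : ℝ), ∀ α ∈ rootSystem B L, 0 < B α v → 0 ≤ B α (v + ε • z) := by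
  obtain ⟨q, hq, hint⟩ := exists_common_denominator hr
  obtain ⟨m, hm, hmv⟩ := hB.exists_pos_mul_norm_sq_le hv
  have hq' : (0 : ℝ) < q := by exact_mod_cast hq
  set C := ‖LinearMap.toContinuousLinearMap (B z)‖ with hC
  have hCz : ∀ x, |B x z| ≤ C * ‖x‖ := fun x => by
    rw [hB.symm]; exact (LinearMap.toContinuousLinearMap (B z)).le_opNorm x
  have hvv := neg_pos.mpr hv
  have e1 : ∀ᶠ ε in 𝓝 (0 : ℝ), 2 * (ε ^ 2 * C ^ 2) / (-B v v) < m / 2 := by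
    have hc : Continuous fun ε : ℝ => 2 * (ε ^ 2 * C ^ 2) / (-B v v) := by fun_prop
    have := hc.tendsto 0
    exact this.eventually (gt_mem_nhds (by simpa using hm))
  have e2 : ∀ᶠ ε in 𝓝 (0 : ℝ), ∀ β ∈ {β : V | (∀ l ∈ L, ∃ m : ℤ, B β l = m) ∧
      ‖β‖ ≤ Real.sqrt (8 * q / m)}, 0 < B β v → 0 ≤ B β (v + ε • z) := by
    rw [(finite_dual_inter_ball hB _).eventually_all]
    intro β _
    by_cases h : 0 < B β v
    · have hc : Continuous fun ε : ℝ => B β v + ε * B β z := by fun_prop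
      filter_upwards [(hc.tendsto 0).eventually (lt_mem_nhds (by simpa using h))] with ε hε _
      simpa using hε.le
    · exact Eventually.of_forall fun ε h' => absurd h' h
  filter_upwards [e1, e2] with ε h1 h2 α hα hαv
  by_contra! hneg
  have hαα := hα.2.1
  obtain ⟨β, hβ⟩ : ∃ β, β = (2 / B α α) • α := ⟨_, rfl⟩
  have hpos : 0 < 2 / B α α := by positivity
  have hβv : ∀ x, B β x = 2 / B α α * B α x := fun x => by simp [hβ]
  have b1 : 0 < B β v := by rw [hβv]; positivity
  have b2 : B β (v + ε • z) < 0 := by rw [hβv]; exact mul_neg_of_pos_of_neg hpos hneg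
  have b3 : B β β ≤ 4 * q := by
    have : B β β = 4 / B α α := by simp [hβ]; field_simp; norm_num
    rw [this, div_le_iff₀ hαα]
    nlinarith [one_le_mul_norm_of_mem_rootSystem hq hint hα]
  refine absurd (h2 β ⟨fun l hl => ?_, ?_⟩ b1) (not_le.mpr b2)
  · obtain ⟨k, hk⟩ := hα.2.2.1 l hl
    exact ⟨k, by rw [hβv, hk]; field_simp⟩
  · refine Real.le_sqrt_of_sq_le ?_
    rw [le_div_iff₀ hm]
    have b4 : B v β ^ 2 ≤ ε ^ 2 * C ^ 2 * ‖β‖ ^ 2 := by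
      rw [hB.symm v, ← mul_pow, ← mul_pow]
      have b5 : B β v ≤ |ε| * |B β z| := by
        replace b2 : B β v + ε * B β z < 0 := by
          rwa [LinearMap.map_add, LinearMap.map_smul, smul_eq_mul] at b2
        have := neg_abs_le (ε * B β z)
        rw [abs_mul] at this; linarith
      refine sq_le_sq.mpr ?_
      rw [abs_of_pos b1, mul_assoc, abs_mul, abs_of_nonneg (a := C * ‖β‖) (by positivity)]
      exact b5.trans (mul_le_mul_of_nonneg_left (hCz β) (abs_nonneg _))
    have b6 : 2 * B v β ^ 2 / (-B v v) ≤ m / 2 * ‖β‖ ^ 2 := by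
      calc 2 * B v β ^ 2 / (-B v v) ≤ 2 * (ε ^ 2 * C ^ 2 * ‖β‖ ^ 2) / (-B v v) := by gcongr
        _ = 2 * (ε ^ 2 * C ^ 2) / (-B v v) * ‖β‖ ^ 2 := by ring
        _ ≤ m / 2 * ‖β‖ ^ 2 := mul_le_mul_of_nonneg_right h1.le (sq_nonneg _)
    nlinarith [hmv β]

/-! ### Rational subspaces -/

omit [FiniteDimensional ℝ V] in
theorem mem_span_orthogonal_of_finite {q : ℤ} (hq : 0 < q)
    (hint : ∀ x ∈ L, ∀ y ∈ L, ∃ m : ℤ, (q : ℝ) * B x y = m)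
    (A : Finset V) (hA : ∀ α ∈ A, α ∈ L) {w : V} (hw : ∀ α ∈ A, B α w = 0) :
    w ∈ Submodule.span ℝ {l | l ∈ L ∧ ∀ α ∈ A, B α l = 0} := by
  classical
  induction A using Finset.induction_on generalizing w with
  | empty =>
    have : w ∈ Submodule.span ℝ (L : Set V) := by rw [IsZLattice.span_top]; trivial
    simpa using this
  | insert a A _ ih =>
    simp only [Finset.mem_insert, forall_eq_or_imp] at hA hw ⊢
    by_cases h : ∃ l₀ ∈ L, (∀ α ∈ A, B α l₀ = 0) ∧ B a l₀ ≠ 0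
    · obtain ⟨l₀, hl₀, hl₀A, hal₀⟩ := h
      -- This map projects, up to a scalar, along `l₀` onto the complement of `a`.
      have key : ∀ x ∈ Submodule.span ℝ {l | l ∈ L ∧ ∀ α ∈ A, B α l = 0},
          (q * B a l₀) • x - (q * B a x) • l₀ ∈
            Submodule.span ℝ {l | l ∈ L ∧ B a l = 0 ∧ ∀ α ∈ A, B α l = 0} := by
        intro x hx
        induction hx using Submodule.span_induction with
        | mem x hx =>
          refine Submodule.subset_span ⟨?_, by simp; ring, fun α hα => ?_⟩
          · obtain ⟨c, hc⟩ := hint a hA.1 l₀ hl₀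
            obtain ⟨d, hd⟩ := hint a hA.1 x hx.1
            rw [hc, hd, Int.cast_smul_eq_zsmul, Int.cast_smul_eq_zsmul]
            exact L.sub_mem (L.smul_mem _ hx.1) (L.smul_mem _ hl₀)
          · simp [hx.2 α hα, hl₀A α hα]
        | zero => simp
        | add x y _ _ hx hy =>
          convert Submodule.add_mem _ hx hy using 1
          rw [map_add]; module
        | smul c x _ hx =>
          convert Submodule.smul_mem _ c hx using 1
          rw [map_smul, smul_eq_mul]; module
      have := key w (ih hA.2 hw.2)
      rw [hw.1, mul_zero, zero_smul, sub_zero] at this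
      have hne : (q : ℝ) * B a l₀ ≠ 0 := mul_ne_zero (by exact_mod_cast hq.ne') hal₀
      have h2 := Submodule.smul_mem _ (q * B a l₀ : ℝ)⁻¹ this
      rwa [smul_smul, inv_mul_cancel₀ hne, one_smul] at h2
    · push Not at h
      refine Submodule.span_mono ?_ (ih hA.2 hw.2)
      exact fun l hl => ⟨hl.1, h l hl.1 hl.2, hl.2⟩

/-- The orthogonal complement of a set of lattice vectors is a rational subspace: it is spanned by
the lattice vectors which it contains. -/
theorem mem_span_lattice_orthogonal
    (hr : ∀ x ∈ L, ∀ y ∈ L, ∃ q : ℚ, B x y = q) {A : Set V} (hA : A ⊆ L) {w : V}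
    (hw : ∀ α ∈ A, B α w = 0) :
    w ∈ Submodule.span ℝ {l | l ∈ L ∧ ∀ α ∈ A, B α l = 0} := by
  obtain ⟨q, hq, hint⟩ := exists_common_denominator hr
  obtain ⟨A', hA', hspan⟩ := (Submodule.fg_span_iff_fg_span_finset_subset A).mp
    (IsNoetherian.noetherian (Submodule.span ℝ A))
  refine Submodule.span_mono ?_ (mem_span_orthogonal_of_finite hq hint A'
    (fun α hα => hA (hA' hα)) fun α hα => hw α (hA' hα))
  refine fun l hl => ⟨hl.1, fun α hα => ?_⟩
  exact form_eq_zero_of_mem_span hl.2 (hspan ▸ Submodule.subset_span hα)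

end Lattice

section Chamber

variable {V : Type*} [NormedAddCommGroup V] [NormedSpace ℝ V]
variable {B : LinearMap.BilinForm ℝ V} {L : Submodule ℤ V}

/-! ### The topology of projective space -/

theorem isQuotientMap_mk : IsQuotientMap (Projectivization.mk' ℝ (V := V)) :=
  isQuotientMap_quotient_mk'

/-- The sign of a function on projective space given by a function on `V` homogeneous of degree `2`
does not depend on the representative. -/
theorem rep_neg_iff {f : V → ℝ} (hf : ∀ (a : ℝ) v, f (a • v) = a ^ 2 * f v) (v : V) (hv : v ≠ 0) :
    f (Projectivization.mk ℝ v hv).rep < 0 ↔ f v < 0 := by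
  obtain ⟨a, ha⟩ := Projectivization.exists_smul_eq_mk_rep ℝ v hv
  rw [← ha, Units.smul_def, hf]
  have := pow_pos (abs_pos.mpr a.ne_zero) 2
  rw [sq_abs] at this
  exact ⟨fun h => by_contra fun h' => absurd h (mul_nonneg this.le (not_lt.mp h')).not_gt,
    mul_neg_of_pos_of_neg this⟩

theorem isOpen_rep_neg {f : V → ℝ} (hf : ∀ (a : ℝ) v, f (a • v) = a ^ 2 * f v)
    (hc : Continuous f) : IsOpen {p : Projectivization ℝ V | f p.rep < 0} := by
  rw [← isQuotientMap_mk.isOpen_preimage]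
  have : Projectivization.mk' ℝ ⁻¹' {p : Projectivization ℝ V | f p.rep < 0} =
      {v : {v : V // v ≠ 0} | f v < 0} := by
    ext v
    exact rep_neg_iff hf v.1 v.2
  rw [this]
  exact isOpen_lt (hc.comp continuous_subtype_val) continuous_const

theorem mk_neg {v : V} (hv : v ≠ 0) :
    Projectivization.mk ℝ (-v) (neg_ne_zero.mpr hv) = Projectivization.mk ℝ v hv := by
  rw [Projectivization.mk_eq_mk_iff']
  exact ⟨-1, by simp⟩

theorem mk_mem_hyperbolicSpace {v : V} {hv : v ≠ 0} :
    Projectivization.mk ℝ v hv ∈ hyperbolicSpace B ↔ B v v < 0 :=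
  rep_neg_iff (f := fun x => B x x) (fun a v => by simp; ring) v hv

theorem mk_mem_idealBoundary {v : V} {hv : v ≠ 0} :
    Projectivization.mk ℝ v hv ∈ idealBoundary B ↔ B v v = 0 := by
  obtain ⟨a, ha⟩ := Projectivization.exists_smul_eq_mk_rep ℝ v hv
  change B _ _ = 0 ↔ _
  rw [← ha, Units.smul_def]
  simp

theorem mk_mem_mirror {v α : V} {hv : v ≠ 0} (hvv : B v v < 0) (hα : 0 < B α α) :
    Projectivization.mk ℝ v hv ∈ mirror B α ↔ B α v = 0 := by
  change _ ∧ _ ↔ _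
  rw [mk_mem_hyperbolicSpace, Projectivization.submodule_mk, Submodule.map_span,
    Set.image_singleton]
  have e : reflection B α v = v - (2 / B α α * B α v) • α := by
    simp [reflection, smul_smul]
  constructor
  · rintro ⟨-, h⟩
    have hm : reflection B α v ∈ Submodule.span ℝ {v} := h ▸ Submodule.mem_span_singleton_self _
    obtain ⟨c, hc⟩ := Submodule.mem_span_singleton.mp hm
    rw [e] at hc
    have h1 : (2 / B α α * B α v) • α = (1 - c) • v := by
      rw [sub_smul, one_smul, hc]; abel
    have h2 : (2 / B α α * B α v) ^ 2 * B α α = (1 - c) ^ 2 * B v v := by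
      have : B ((2 / B α α * B α v) • α) ((2 / B α α * B α v) • α) =
        B ((1 - c) • v) ((1 - c) • v) := by rw [h1]
      simp only [map_smul, LinearMap.smul_apply, smul_eq_mul] at this
      linear_combination this
    by_contra h0
    have h3 : 2 / B α α * B α v ≠ 0 := mul_ne_zero (div_pos two_pos hα).ne' h0
    have := mul_pos (pow_pos (abs_pos.mpr h3) 2) hα
    rw [sq_abs] at this
    nlinarith [mul_nonneg (sq_nonneg (1 - c)) (neg_pos.mpr hvv).le]
  · intro h
    refine ⟨hvv, ?_⟩
    rw [e, h, mul_zero, zero_smul, sub_zero]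

/-! ### Weyl chambers as cones -/

/-- The cone over the Weyl chamber that contains `x₀` in its interior: the nonzero causal vectors in
the same half of the light cone as `x₀` on which no root changes its sign at `x₀`. -/
def chamberCone (B : LinearMap.BilinForm ℝ V) (L : Submodule ℤ V) (x₀ : V) : Set V :=
  {v | v ≠ 0 ∧ B v v ≤ 0 ∧ B x₀ v < 0 ∧ ∀ α ∈ rootSystem B L, 0 < B α x₀ → 0 ≤ B α v}

/-- The image of `chamberCone` in projective space. -/
def chamber (B : LinearMap.BilinForm ℝ V) (L : Submodule ℤ V) (x₀ : V) :
    Set (Projectivization ℝ V) :=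
  {p | ∃ v, ∃ hv : v ≠ 0, v ∈ chamberCone B L x₀ ∧ Projectivization.mk ℝ v hv = p}

/-- `x₀` is a timelike vector on no mirror. -/
def IsRegular (B : LinearMap.BilinForm ℝ V) (L : Submodule ℤ V) (x₀ : V) : Prop :=
  B x₀ x₀ < 0 ∧ ∀ α ∈ rootSystem B L, B α x₀ ≠ 0

theorem mk_mem_mirrorComplement {v : V} {hv : v ≠ 0} :
    Projectivization.mk ℝ v hv ∈ mirrorComplement B L ↔ IsRegular B L v := by
  change _ ∧ _ ↔ _ ∧ _
  rw [mk_mem_hyperbolicSpace]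
  refine and_congr_right fun hvv => ?_
  simp only [Set.mem_iUnion, not_exists]
  exact forall₂_congr fun α hα => not_congr (mk_mem_mirror hvv hα.2.1)

/-- One inclusion in the description of a Weyl chamber as a cone: the segment from `x₀` to a point
of the cone meets no mirror, except possibly at its end. -/
theorem mk_mem_closure_of_mem_chamberCone (hB : IsMinkowski B) {x₀ : V} {hx₀ : x₀ ≠ 0}
    (hreg : IsRegular B L x₀) {v : V} (hv : v ∈ chamberCone B L x₀) :
    Projectivization.mk ℝ v hv.1 ∈ closure (connectedComponentIn (mirrorComplement B L)
      (Projectivization.mk ℝ x₀ hx₀)) := by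
  obtain ⟨hv0, hvv, hx₀v, hvα⟩ := hv
  have htime : ∀ t : ℝ, 0 ≤ t → t < 1 →
      B ((1 - t) • x₀ + t • v) ((1 - t) • x₀ + t • v) < 0 := by
    intro t ht0 ht1
    have e : B ((1 - t) • x₀ + t • v) ((1 - t) • x₀ + t • v) =
        (1 - t) ^ 2 * B x₀ x₀ + 2 * (t * (1 - t)) * B x₀ v + t ^ 2 * B v v := by
      simp [hB.symm v x₀]; ring
    rw [e]
    have h1 : 0 < 1 - t := by linarith
    nlinarith [mul_neg_of_pos_of_neg (pow_pos h1 2) hreg.1,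
      mul_nonpos_of_nonneg_of_nonpos (mul_nonneg ht0 h1.le) hx₀v.le,
      mul_nonpos_of_nonneg_of_nonpos (sq_nonneg t) hvv]
  have hne : ∀ t : unitInterval, (1 - (t : ℝ)) • x₀ + (t : ℝ) • v ≠ 0 := by
    intro t h
    rcases t.2.2.lt_or_eq with h1 | h1
    · have := htime t t.2.1 h1
      simp [h] at this
    · rw [h1] at h
      simp [hv0] at h
  let F : unitInterval → Projectivization ℝ V := fun t => Projectivization.mk' ℝ ⟨_, hne t⟩
  have hc : Continuous fun t : unitInterval => (1 - (t : ℝ)) • x₀ + (t : ℝ) • v := by fun_prop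
  have hF : Continuous F := isQuotientMap_mk.continuous.comp (hc.subtype_mk hne)
  have hsub : F '' Set.Iio 1 ⊆ connectedComponentIn (mirrorComplement B L)
      (Projectivization.mk ℝ x₀ hx₀) := by
    refine (isPreconnected_Iio.image F hF.continuousOn).subset_connectedComponentIn
      ⟨0, Set.mem_Iio.mpr zero_lt_one, ?_⟩ ?_
    · simp [F, Projectivization.mk'_eq_mk]
    · rintro _ ⟨t, ht, rfl⟩
      have ht1 : (t : ℝ) < 1 := ht
      refine mk_mem_mirrorComplement.mpr ⟨htime t t.2.1 ht1, fun α hα => ?_⟩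
      rw [map_add, map_smul, map_smul, smul_eq_mul, smul_eq_mul]
      have key : ∀ β ∈ rootSystem B L, 0 < B β x₀ → 0 < (1 - t) * B β x₀ + t * B β v :=
        fun β hβ h => add_pos_of_pos_of_nonneg (mul_pos (by linarith) h)
          (mul_nonneg t.2.1 (hvα β hβ h))
      rcases lt_or_gt_of_ne (hreg.2 α hα) with h | h
      · have := key (-α) (neg_mem_rootSystem hα) (by simpa using h)
        simp only [map_neg, LinearMap.neg_apply] at this
        exact (by linarith : (1 - t) * B α x₀ + t * B α v < 0).ne
      · exact (key α hα h).ne'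
  have h1 : (1 : unitInterval) ∈ closure (Set.Iio (1 : unitInterval)) := by
    rw [closure_Iio' ⟨0, Set.mem_Iio.mpr zero_lt_one⟩]; exact Set.mem_Iic.mpr le_rfl
  have h2 := closure_mono hsub (image_closure_subset_closure_image hF ⟨1, h1, rfl⟩)
  have h3 : F 1 = Projectivization.mk ℝ v hv0 := by
    simp [F, Projectivization.mk'_eq_mk]
  rwa [h3] at h2

variable [FiniteDimensional ℝ V]

/-- The other inclusion: no root changes sign on a
component of the complement of the mirrors. -/
theorem mem_chamberCone_of_mk_mem (hB : IsMinkowski B) {x₀ : V} {hx₀ : x₀ ≠ 0}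
    (hreg : IsRegular B L x₀) {v : V} {hv : v ≠ 0}
    (h : Projectivization.mk ℝ v hv ∈ closure (connectedComponentIn (mirrorComplement B L)
      (Projectivization.mk ℝ x₀ hx₀))) :
    v ∈ chamberCone B L x₀ ∨ -v ∈ chamberCone B L x₀ := by
  set S := connectedComponentIn (mirrorComplement B L) (Projectivization.mk ℝ x₀ hx₀)
  have hSM : S ⊆ mirrorComplement B L := connectedComponentIn_subset _ _
  have hregS : ∀ p ∈ S, IsRegular B L p.rep := fun p hp => by
    rw [← mk_mem_mirrorComplement (hv := p.rep_nonzero), Projectivization.mk_rep]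
    exact hSM hp
  have hxS : Projectivization.mk ℝ x₀ hx₀ ∈ S :=
    mem_connectedComponentIn (mk_mem_mirrorComplement.mpr hreg)
  have hn1 : ∀ (a : ℝ) (w : V), -B (a • w) (a • w) = a ^ 2 * -B w w := fun a w => by simp; ring
  have hvv : B v v ≤ 0 := by
    by_contra! hpos
    obtain ⟨p, hp, hpS⟩ := mem_closure_iff.mp h _
      (isOpen_rep_neg hn1 (continuous_form_self B).neg)
      ((rep_neg_iff hn1 v hv).mpr (neg_neg_of_pos hpos))
    have h1 := (hregS p hpS).1
    have h2 : -B p.rep p.rep < 0 := hp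
    linarith
  have hsign : ∀ α ∈ rootSystem B L, 0 < B α x₀ → B α v * B x₀ v ≤ 0 := by
    intro α hα hαx
    have hf : ∀ (a : ℝ) (w : V), B α (a • w) * B x₀ (a • w) = a ^ 2 * (B α w * B x₀ w) :=
      fun a w => by simp; ring
    have hf' : ∀ (a : ℝ) (w : V),
        -(B α (a • w) * B x₀ (a • w)) = a ^ 2 * -(B α w * B x₀ w) := fun a w => by simp; ring
    have hc : Continuous fun w => B α w * B x₀ w :=
      (continuous_inner B α).mul (continuous_inner B x₀)
    have hsub : S ⊆ {p | B α p.rep * B x₀ p.rep < 0} := by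
      refine isPreconnected_connectedComponentIn.subset_left_of_subset_union
        (isOpen_rep_neg hf hc) (isOpen_rep_neg hf' hc.neg) ?_ ?_
        ⟨_, hxS, (rep_neg_iff (f := fun w => B α w * B x₀ w) hf x₀ hx₀).mpr
          (mul_neg_of_pos_of_neg hαx hreg.1)⟩
      · rw [Set.disjoint_left]
        intro p h1 h2
        have h1 : B α p.rep * B x₀ p.rep < 0 := h1
        have h2 : -(B α p.rep * B x₀ p.rep) < 0 := h2
        linarith
      · intro p hp
        have hr := hregS p hp
        have h1 := hB.inner_ne_zero hreg.1 hr.1.le p.rep_nonzero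
        rcases lt_or_gt_of_ne (mul_ne_zero (hr.2 α hα) h1) with h | h
        · exact Or.inl h
        · exact Or.inr (neg_neg_of_pos h)
    by_contra! hpos
    obtain ⟨p, hp, hpS⟩ := mem_closure_iff.mp h _ (isOpen_rep_neg hf' hc.neg)
      ((rep_neg_iff hf' v hv).mpr (neg_neg_of_pos hpos))
    have h1 : B α p.rep * B x₀ p.rep < 0 := hsub hpS
    have h2 : -(B α p.rep * B x₀ p.rep) < 0 := hp
    linarith
  rcases lt_or_gt_of_ne (hB.inner_ne_zero hreg.1 hvv hv) with h0 | h0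
  · exact Or.inl ⟨hv, hvv, h0, fun α hα hαx => nonneg_of_mul_nonpos_left (hsign α hα hαx) h0⟩
  · refine Or.inr ⟨neg_ne_zero.mpr hv, by simpa using hvv, by simpa using h0,
      fun α hα hαx => ?_⟩
    have := hsign α hα hαx
    rw [map_neg]
    have := nonpos_of_mul_nonpos_left this h0
    linarith

theorem IsWeylChamber.exists_eq_chamber (hB : IsMinkowski B) {C : Set (Projectivization ℝ V)}
    (hC : IsWeylChamber B L C) : ∃ x₀, IsRegular B L x₀ ∧ C = chamber B L x₀ := by
  obtain ⟨x, hx, rfl⟩ := hC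
  rw [← x.mk_rep] at hx ⊢
  have hreg := mk_mem_mirrorComplement.mp hx
  refine ⟨x.rep, hreg, Set.ext fun p => ⟨fun hp => ?_, ?_⟩⟩
  · rw [← p.mk_rep] at hp
    rcases mem_chamberCone_of_mk_mem hB hreg hp with h | h
    · exact ⟨p.rep, p.rep_nonzero, h, p.mk_rep⟩
    · exact ⟨-p.rep, h.1, h, by rw [mk_neg p.rep_nonzero, p.mk_rep]⟩
  · rintro ⟨v, _, hv, rfl⟩
    exact mk_mem_closure_of_mem_chamberCone hB hreg hv

end Chamber

section Cone

variable {V : Type*} [NormedAddCommGroup V] [NormedSpace ℝ V]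
variable {B : LinearMap.BilinForm ℝ V} {L : Submodule ℤ V} {x₀ : V}

theorem mk_mem_chamber {v : V} (hv : v ∈ chamberCone B L x₀) :
    Projectivization.mk ℝ v hv.1 ∈ chamber B L x₀ :=
  ⟨v, hv.1, hv, rfl⟩

theorem mk_smul {c : ℝ} {v : V} (hv : v ≠ 0) (hcv : c • v ≠ 0) :
    Projectivization.mk ℝ (c • v) hcv = Projectivization.mk ℝ v hv := by
  rw [Projectivization.mk_eq_mk_iff']
  exact ⟨c, rfl⟩

theorem smul_mem_chamberCone {v : V} (hv : v ∈ chamberCone B L x₀) {c : ℝ} (hc : 0 < c) :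
    c • v ∈ chamberCone B L x₀ := by
  obtain ⟨h1, h2, h3, h4⟩ := hv
  refine ⟨smul_ne_zero hc.ne' h1, ?_, ?_, fun α hα h => ?_⟩
  · simp only [map_smul, LinearMap.smul_apply, smul_eq_mul]
    exact mul_nonpos_of_nonneg_of_nonpos hc.le (mul_nonpos_of_nonneg_of_nonpos hc.le h2)
  · rw [map_smul]; exact mul_neg_of_pos_of_neg hc h3
  · rw [map_smul]; exact mul_nonneg hc.le (h4 α hα h)

theorem inner_nonpos_of_mem (hB : IsMinkowski B) (hreg : IsRegular B L x₀) {u v : V}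
    (hu : u ∈ chamberCone B L x₀) (hv : v ∈ chamberCone B L x₀) : B u v ≤ 0 :=
  hB.inner_nonpos hreg.1 hu.2.1 hv.2.1 hu.2.2.1 hv.2.2.1

theorem add_mem_chamberCone (hB : IsMinkowski B) (hreg : IsRegular B L x₀) {u v : V}
    (hu : u ∈ chamberCone B L x₀) (hv : v ∈ chamberCone B L x₀) :
    u + v ∈ chamberCone B L x₀ := by
  have huv := inner_nonpos_of_mem hB hreg hu hv
  have h1 : B x₀ (u + v) < 0 := by rw [map_add]; exact add_neg hu.2.2.1 hv.2.2.1
  refine ⟨fun h => by simp [h] at h1, ?_, h1, fun α hα h => ?_⟩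
  · have e : B (u + v) (u + v) = B u u + B v v + 2 * B u v := by simp [hB.symm v u]; ring
    rw [e]; linarith [hu.2.1, hv.2.1]
  · rw [map_add]; exact add_nonneg (hu.2.2.2 α hα h) (hv.2.2.2 α hα h)

theorem inner_add_self_neg (hB : IsMinkowski B) {u v : V} (hu : u ∈ chamberCone B L x₀)
    (hv : v ∈ chamberCone B L x₀) (huv : B u v < 0) : B (u + v) (u + v) < 0 := by
  have e : B (u + v) (u + v) = B u u + B v v + 2 * B u v := by simp [hB.symm v u]; ring
  linarith [hu.2.1, hv.2.1]

/-- A root does not take values of both signs on a chamber. -/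
theorem root_nonneg_of_pos (hreg : IsRegular B L x₀) {α : V} (hα : α ∈ rootSystem B L) {u v : V}
    (hu : u ∈ chamberCone B L x₀) (hv : v ∈ chamberCone B L x₀) (h : 0 < B α u) : 0 ≤ B α v := by
  rcases lt_or_gt_of_ne (hreg.2 α hα) with h0 | h0
  · have := hu.2.2.2 (-α) (neg_mem_rootSystem hα) (by simpa using h0)
    simp only [map_neg, LinearMap.neg_apply] at this
    linarith
  · exact hv.2.2.2 α hα h0

theorem root_nonpos_of_neg (hreg : IsRegular B L x₀) {α : V} (hα : α ∈ rootSystem B L) {u v : V}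
    (hu : u ∈ chamberCone B L x₀) (hv : v ∈ chamberCone B L x₀) (h : B α u < 0) : B α v ≤ 0 := by
  simpa using root_nonneg_of_pos hreg (neg_mem_rootSystem hα) hu hv (by simpa using h)

/-- A root that vanishes inside a segment of the chamber vanishes at its ends. -/
theorem root_eq_zero_of_add (hreg : IsRegular B L x₀) {α : V} (hα : α ∈ rootSystem B L) {u v : V}
    (hu : u ∈ chamberCone B L x₀) (hv : v ∈ chamberCone B L x₀) {s t : ℝ} (hs : 0 < s) (ht : 0 < t)
    (h : B α (s • u + t • v) = 0) : B α u = 0 ∧ B α v = 0 := by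
  simp only [map_add, map_smul, smul_eq_mul] at h
  rcases lt_trichotomy (B α u) 0 with h1 | h1 | h1
  · have := root_nonpos_of_neg hreg hα hu hv h1
    nlinarith [mul_neg_of_pos_of_neg hs h1, mul_nonpos_of_nonneg_of_nonpos ht.le this]
  · rw [h1, mul_zero, zero_add] at h
    exact ⟨h1, (mul_eq_zero.mp h).resolve_left ht.ne'⟩
  · have := root_nonneg_of_pos hreg hα hu hv h1
    nlinarith [mul_pos hs h1, mul_nonneg ht.le this]

/-! ### Edges -/

theorem closedGeodesic_comm (hs : ∀ x y, B x y = B y x) (a b : Projectivization ℝ V) :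
    closedGeodesic B a b = closedGeodesic B b a := by
  have key : ∀ a b : Projectivization ℝ V, openGeodesic B a b ⊆ openGeodesic B b a := by
    rintro a b p ⟨u, hu, v, hv, h1, h2, h3⟩
    exact ⟨v, hv, u, hu, by rwa [hs], by rwa [add_comm], by rwa [add_comm]⟩
  rw [closedGeodesic, closedGeodesic, Set.pair_comm, (key a b).antisymm (key b a)]

theorem mk_mem_openGeodesic {u v w : V} (hu : u ≠ 0) (hv : v ≠ 0) (hw : w ≠ 0) {s t : ℝ}
    (h : s • u + t • v = w) (hst : s * t * B u v < 0) :
    Projectivization.mk ℝ w hw ∈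
      openGeodesic B (Projectivization.mk ℝ u hu) (Projectivization.mk ℝ v hv) := by
  simp only [openGeodesic, Projectivization.submodule_mk]
  refine ⟨s • u, Submodule.smul_mem _ _ (Submodule.mem_span_singleton_self _), t • v,
    Submodule.smul_mem _ _ (Submodule.mem_span_singleton_self _), ?_, by rwa [h], ?_⟩
  · simpa [mul_assoc, mul_left_comm] using hst
  · rw [h]; exact Submodule.mem_span_singleton_self _

/-- The points of the closed geodesic between two points of the chamber are represented in the cone
by nonnegative combinations. -/
theorem exists_of_mk_mem_closedGeodesic (hB : IsMinkowski B) (hreg : IsRegular B L x₀)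
    {u v w : V} (hu : u ∈ chamberCone B L x₀) (hv : v ∈ chamberCone B L x₀)
    (hw : w ∈ chamberCone B L x₀)
    (h : Projectivization.mk ℝ w hw.1 ∈
      closedGeodesic B (Projectivization.mk ℝ u hu.1) (Projectivization.mk ℝ v hv.1)) :
    ∃ s t : ℝ, 0 ≤ s ∧ 0 ≤ t ∧ w = s • u + t • v := by
  have hw0 := hw.2.2.1
  have hu0 := hu.2.2.1
  have hv0 := hv.2.2.1
  rcases h with (h | h) | h
  · obtain ⟨c, hc⟩ := (Projectivization.mk_eq_mk_iff' ℝ _ _ _ _).mp h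
    refine ⟨c, 0, ?_, le_rfl, by simp [hc]⟩
    rw [← hc, map_smul, smul_eq_mul] at hw0
    exact (pos_of_mul_neg_left hw0 hu0.le).le
  · obtain ⟨c, hc⟩ := (Projectivization.mk_eq_mk_iff' ℝ _ _ _ _).mp h
    refine ⟨0, c, le_rfl, ?_, by simp [hc]⟩
    rw [← hc, map_smul, smul_eq_mul] at hw0
    exact (pos_of_mul_neg_left hw0 hv0.le).le
  · simp only [openGeodesic, Set.mem_ofPred_eq, Projectivization.submodule_mk,
      Submodule.mem_span_singleton] at h
    obtain ⟨_, ⟨s, rfl⟩, _, ⟨t, rfl⟩, h1, h2, c, hc⟩ := h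
    have hc0 : c ≠ 0 := by
      rintro rfl
      exact h2 (by rw [← hc, zero_smul])
    have hw' : w = (s / c) • u + (t / c) • v := by
      have : c⁻¹ • c • w = c⁻¹ • (s • u + t • v) := by rw [hc]
      rw [smul_smul, inv_mul_cancel₀ hc0, one_smul] at this
      rw [this, smul_add, smul_smul, smul_smul, div_eq_inv_mul, div_eq_inv_mul]
    simp only [map_smul, LinearMap.smul_apply, smul_eq_mul] at h1
    have huv := inner_nonpos_of_mem hB hreg hu hv
    have hst : 0 < s * t := pos_of_mul_neg_left (by linarith : s * t * B u v < 0) huv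
    have hst' : 0 < (s / c) * (t / c) := by
      rw [div_mul_div_comm]; exact div_pos hst (mul_self_pos.mpr hc0)
    rw [hw', map_add, map_smul, map_smul, smul_eq_mul, smul_eq_mul] at hw0
    rcases pos_and_pos_or_neg_and_neg_of_mul_pos hst' with ⟨h3, h4⟩ | ⟨h3, h4⟩
    · exact ⟨_, _, h3.le, h4.le, hw'⟩
    · linarith [mul_pos_of_neg_of_neg h3 hu0, mul_pos_of_neg_of_neg h4 hv0]

variable [FiniteDimensional ℝ V] [DiscreteTopology L] [IsZLattice ℝ L]

/-- Near a timelike point, the chamber is cut out by the roots vanishing at that point. -/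
theorem eventually_mem_chamberCone (hB : IsMinkowski B)
    (hr : ∀ x ∈ L, ∀ y ∈ L, ∃ q : ℚ, B x y = q) {w z : V}
    (hw : w ∈ chamberCone B L x₀) (hww : B w w < 0)
    (hz : ∀ α ∈ rootSystem B L, B α w = 0 → B α z = 0) :
    ∀ᶠ ε in 𝓝 (0 : ℝ), w + ε • z ∈ chamberCone B L x₀ ∧ B (w + ε • z) (w + ε • z) < 0 := by
  have hc : Continuous fun ε : ℝ => w + ε • z := by fun_prop
  have e1 := (((continuous_form_self B).comp hc).tendsto 0).eventually_lt_const (u := 0)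
    (by simpa using hww)
  have e2 := (((continuous_inner B x₀).comp hc).tendsto 0).eventually_lt_const (u := 0)
    (by simpa using hw.2.2.1)
  filter_upwards [e1, e2, eventually_forall_root_nonneg hB hr hww z] with ε h1 h2 h3
  have h1 : B (w + ε • z) (w + ε • z) < 0 := h1
  refine ⟨⟨fun h => by simp [h] at h1, h1.le, h2, fun α hα hαx => ?_⟩, h1⟩
  rcases (hw.2.2.2 α hα hαx).lt_or_eq with h | h
  · exact h3 α hα h
  · rw [map_add, map_smul, ← h, hz α hα h.symm]; simp

/-- If every root vanishing at the timelike point `w` of an edge vanishes at `z`, the edge contains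
a neighborhood of `w` on the geodesic in the direction of `z`. -/
theorem IsEdge.exists_add_smul (hB : IsMinkowski B)
    (hr : ∀ x ∈ L, ∀ y ∈ L, ∃ q : ℚ, B x y = q) (hreg : IsRegular B L x₀)
    {u v w z : V} (hu : u ∈ chamberCone B L x₀) (hv : v ∈ chamberCone B L x₀)
    (hE : IsEdge B (chamber B L x₀)
      (closedGeodesic B (Projectivization.mk ℝ u hu.1) (Projectivization.mk ℝ v hv.1)))
    (hw : w ∈ chamberCone B L x₀) (hww : B w w < 0)
    (hwe : Projectivization.mk ℝ w hw.1 ∈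
      closedGeodesic B (Projectivization.mk ℝ u hu.1) (Projectivization.mk ℝ v hv.1))
    (hz : ∀ α ∈ rootSystem B L, B α w = 0 → B α z = 0) :
    ∃ ε : ℝ, ε ≠ 0 ∧ (∃ s t : ℝ, 0 ≤ s ∧ 0 ≤ t ∧ w + ε • z = s • u + t • v) ∧
      ∃ s t : ℝ, 0 ≤ s ∧ 0 ≤ t ∧ w - ε • z = s • u + t • v := by
  have e1 := eventually_mem_chamberCone hB hr hw hww hz
  have e2 := eventually_mem_chamberCone (z := -z) hB hr hw hww fun α hα h => by simp [hz α hα h]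
  obtain ⟨ε, ⟨⟨h1, h1'⟩, h2, h2'⟩, hε⟩ :=
    (((e1.and e2).filter_mono nhdsWithin_le_nhds).and
      (self_mem_nhdsWithin : {(0 : ℝ)}ᶜ ∈ 𝓝[≠] (0 : ℝ))).exists
  rw [smul_neg, ← sub_eq_add_neg] at h2 h2'
  have hneg := hB.inner_neg_of_timelike hreg.1 h1' h2'.le h1.2.2.1 h2.2.2.1
  have hop : Projectivization.mk ℝ w hw.1 ∈ openGeodesic B
      (Projectivization.mk ℝ _ h1.1) (Projectivization.mk ℝ _ h2.1) :=
    mk_mem_openGeodesic (s := 2⁻¹) (t := 2⁻¹) _ _ _ (by module) (by linarith)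
  obtain ⟨h3, h4⟩ := hE.2.2 _ (mk_mem_chamber h1) _ (mk_mem_chamber h2) ⟨_, hop, hwe⟩
  exact ⟨ε, hε, exists_of_mk_mem_closedGeodesic hB hreg hu hv h1 h3,
    exists_of_mk_mem_closedGeodesic hB hreg hu hv h2 h4⟩

end Cone

section Corner

variable {V : Type*} [NormedAddCommGroup V] [NormedSpace ℝ V]
variable {B : LinearMap.BilinForm ℝ V} {L : Submodule ℤ V} {x₀ : V}

/-! ### Corners in terms of the cone -/

/-- Membership in a horosphere. The factor `a` relates the given representative `r` of its center to
the one chosen by `Projectivization.rep`. -/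
theorem exists_mk_mem_horosphere_iff (hs : ∀ x y, B x y = B y x) {r : V} (hr : r ≠ 0) :
    ∃ a : ℝ, 0 < a ∧ ∀ (c : ℝ) (x : V) (hx : x ≠ 0), B x x < 0 →
      (Projectivization.mk ℝ x hx ∈ horosphere B (Projectivization.mk ℝ r hr) c ↔
        a * B r x ^ 2 = c * -B x x) := by
  obtain ⟨a, ha⟩ := Projectivization.exists_smul_eq_mk_rep ℝ r hr
  refine ⟨(a : ℝ) ^ 2, sq_pos_of_ne_zero a.ne_zero, fun c x hx hxx => ?_⟩
  change _ ∧ _ ↔ _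
  obtain ⟨b, hb⟩ := Projectivization.exists_smul_eq_mk_rep ℝ x hx
  rw [mk_mem_hyperbolicSpace, ← ha, ← hb, Units.smul_def, Units.smul_def, and_iff_right hxx]
  have hb0 : (b : ℝ) ≠ 0 := b.ne_zero
  simp only [map_smul, LinearMap.smul_apply, smul_eq_mul, hs x r]
  rw [div_eq_iff (by simp [hb0, hxx.ne])]
  constructor
  · intro h
    have hb2 : (b : ℝ) ^ 2 ≠ 0 := pow_ne_zero 2 hb0
    refine mul_left_cancel₀ hb2 ?_
    linear_combination h
  · intro h
    linear_combination (b : ℝ) ^ 2 * h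

variable [FiniteDimensional ℝ V]

/-- The horospheres centered at an ideal corner meet the chamber in bounded sets, when their points
are represented by the vectors `x` with `r · x = -1`. -/
theorem IsIdealCorner.exists_norm_le (hB : IsMinkowski B) {r : V} (hr : r ≠ 0)
    (h : IsIdealCorner B (chamber B L x₀) (Projectivization.mk ℝ r hr)) {d : ℝ} (hd : 0 < d) :
    ∃ R, ∀ x ∈ chamberCone B L x₀, B r x = -1 → B x x = -d → ‖x‖ ≤ R := by
  obtain ⟨a, ha, hhor⟩ := exists_mk_mem_horosphere_iff hB.symm hr
  have hc : 0 < a / d := div_pos ha hd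
  have hhom : ∀ (N : ℕ) (b : ℝ) (x : V), ‖b • x‖ ^ 2 - N * B r (b • x) ^ 2 =
      b ^ 2 * (‖x‖ ^ 2 - N * B r x ^ 2) := fun N b x => by
    rw [norm_smul, map_smul, smul_eq_mul, mul_pow, Real.norm_eq_abs, sq_abs]; ring
  have hcont : ∀ N : ℕ, Continuous fun x : V => ‖x‖ ^ 2 - N * B r x ^ 2 := fun N =>
    (continuous_norm.pow 2).sub (continuous_const.mul ((continuous_inner B r).pow 2))
  obtain ⟨N, hN⟩ := (h.2.2 (a / d) hc).elim_directed_cover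
    (fun N : ℕ => {p : Projectivization ℝ V | ‖p.rep‖ ^ 2 - N * B r p.rep ^ 2 < 0})
    (fun N => isOpen_rep_neg (hhom N) (hcont N))
    (by
      rintro p ⟨hp, -⟩
      have hpp : B p.rep p.rep < 0 := hp.1
      rw [← p.mk_rep, hhor _ _ p.rep_nonzero hpp] at hp
      have hne : 0 < B r p.rep ^ 2 := by
        have := mul_pos hc (neg_pos.mpr hpp)
        rw [← hp] at this
        exact pos_of_mul_pos_right this ha.le
      obtain ⟨N, hN⟩ := exists_nat_gt (‖p.rep‖ ^ 2 / B r p.rep ^ 2)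
      rw [div_lt_iff₀ hne] at hN
      exact Set.mem_iUnion.mpr ⟨N, sub_neg.mpr hN⟩)
    (directed_of_isDirected_le fun M N hMN p hp => by
      have hp : ‖p.rep‖ ^ 2 - M * B r p.rep ^ 2 < 0 := hp
      have : (M : ℝ) ≤ N := by exact_mod_cast hMN
      change ‖p.rep‖ ^ 2 - N * B r p.rep ^ 2 < 0
      nlinarith [mul_le_mul_of_nonneg_right this (sq_nonneg (B r p.rep))])
  refine ⟨Real.sqrt N, fun x hx hrx hxx => Real.le_sqrt_of_sq_le ?_⟩
  have hmem := hN ⟨(hhor _ x hx.1 (by linarith)).mpr (by rw [hrx, hxx]; field_simp),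
    mk_mem_chamber hx⟩
  have := (rep_neg_iff (f := fun x => ‖x‖ ^ 2 - N * B r x ^ 2) (hhom N) x hx.1).mp hmem
  rw [hrx] at this
  linarith

/-- Conversely, boundedness of the normalized horospherical sections of the cone suffices, because
these sections are closed in `V`. -/
theorem isIdealCorner_of_forall_exists_norm_le (hB : IsMinkowski B) (hreg : IsRegular B L x₀)
    {r : V} (hr : r ∈ chamberCone B L x₀) (hrr : B r r = 0)
    (h : ∀ d : ℝ, 0 < d →
      ∃ R, ∀ x ∈ chamberCone B L x₀, B r x = -1 → B x x = -d → ‖x‖ ≤ R) :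
    IsIdealCorner B (chamber B L x₀) (Projectivization.mk ℝ r hr.1) := by
  refine ⟨mk_mem_chamber hr, mk_mem_idealBoundary.mpr hrr, fun c hc => ?_⟩
  obtain ⟨a, ha, hhor⟩ := exists_mk_mem_horosphere_iff hB.symm hr.1
  have hd : 0 < a / c := div_pos ha hc
  obtain ⟨R, hR⟩ := h _ hd
  let T : Set V := {x | B r x = -1} ∩ {x | B x x = -(a / c)} ∩
    ⋂ α ∈ rootSystem B L, ⋂ _ : 0 < B α x₀, {x | 0 ≤ B α x}
  have hTK : ∀ x ∈ T, x ∈ chamberCone B L x₀ := by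
    rintro x ⟨⟨h1, h2⟩, h3⟩
    have h1 : B r x = -1 := h1
    have h2 : B x x = -(a / c) := h2
    have hx0 : x ≠ 0 := fun h => by simp [h] at h1
    refine ⟨hx0, by linarith, ?_, fun α hα hαx => ?_⟩
    · rcases lt_or_gt_of_ne (hB.inner_ne_zero hreg.1 (by linarith : B x x ≤ 0) hx0) with h | h
      · exact h
      · have := hB.inner_nonpos (y := -x) hreg.1 hr.2.1 (by simp; linarith) hr.2.2.1 (by simpa)
        rw [map_neg] at this
        linarith
    · exact Set.mem_iInter.mp (Set.mem_iInter₂.mp h3 α hα) hαx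
  have hT : IsCompact T := by
    refine (isCompact_closedBall (0 : V) R).of_isClosed_subset ?_ fun x hx => ?_
    · refine ((isClosed_eq (continuous_inner B r) continuous_const).inter
        (isClosed_eq (continuous_form_self B) continuous_const)).inter ?_
      exact isClosed_biInter fun α _ => isClosed_iInter fun _ =>
        isClosed_le continuous_const (continuous_inner B α)
    · simpa using hR x (hTK x hx) hx.1.1 hx.1.2
  have hT' : IsCompact (Subtype.val ⁻¹' T : Set {v : V // v ≠ 0}) := by
    rw [Topology.IsEmbedding.subtypeVal.isCompact_iff,
      Set.image_preimage_eq_of_subset fun x hx => ⟨⟨x, (hTK x hx).1⟩, rfl⟩]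
    exact hT
  convert hT'.image isQuotientMap_mk.continuous using 1
  ext p
  constructor
  · rintro ⟨hp, v, hv0, hv, rfl⟩
    have hvv := mk_mem_hyperbolicSpace.mp hp.1
    rw [hhor c v hv0 hvv] at hp
    have hrv : B r v < 0 := by
      rw [hB.symm]
      exact hB.inner_neg_of_timelike hreg.1 hvv hr.2.1 hv.2.2.1 hr.2.2.1
    have hpos : 0 < (-B r v)⁻¹ := inv_pos.mpr (neg_pos.mpr hrv)
    have hx := smul_mem_chamberCone hv hpos
    refine ⟨⟨_, hx.1⟩, ⟨⟨?_, ?_⟩, ?_⟩, mk_smul hv0 hx.1⟩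
    · change B r ((-B r v)⁻¹ • v) = -1
      rw [map_smul, smul_eq_mul]; field_simp [hrv.ne]
    · change B ((-B r v)⁻¹ • v) ((-B r v)⁻¹ • v) = -(a / c)
      simp only [map_smul, LinearMap.smul_apply, smul_eq_mul]
      have := hrv.ne
      field_simp
      linear_combination hp
    · exact Set.mem_iInter₂.mpr fun α hα => Set.mem_iInter.mpr fun hαx => hx.2.2.2 α hα hαx
  · rintro ⟨⟨x, hx0⟩, hx, rfl⟩
    have hx : x ∈ T := hx
    have h1 : B r x = -1 := hx.1.1
    have h2 : B x x = -(a / c) := hx.1.2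
    have hxx : B x x < 0 := by linarith
    refine ⟨(hhor c x hx0 hxx).mpr ?_, mk_mem_chamber (hTK x hx)⟩
    rw [h1, h2]
    field_simp

/-- A timelike point is an ordinary corner when the roots vanishing there determine it. -/
theorem isOrdinaryCorner_mk_iff (hB : IsMinkowski B) {n : ℕ} (hn : finrank ℝ V = n + 1) {w : V}
    (hw : w ∈ chamberCone B L x₀) :
    IsOrdinaryCorner B L n (chamber B L x₀) (Projectivization.mk ℝ w hw.1) ↔
      B w w < 0 ∧ ∀ z, (∀ α ∈ rootSystem B L, B α w = 0 → B α z = 0) →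
        z ∈ Submodule.span ℝ {w} := by
  obtain ⟨a, ha⟩ := Projectivization.exists_smul_eq_mk_rep ℝ w hw.1
  have e : {α | α ∈ rootSystem B L ∧ B α (Projectivization.mk ℝ w hw.1).rep = 0} =
      {α | α ∈ rootSystem B L ∧ B α w = 0} := by
    ext α
    simp [← ha, Units.smul_def]
  unfold IsOrdinaryCorner
  rw [and_iff_right (mk_mem_chamber hw), mk_mem_hyperbolicSpace, e,
    hB.finrank_span_eq_iff hn hw.1 (fun α hα => hα.2)]
  simp [and_imp]

end Corner

section Edge

variable {V : Type*} [NormedAddCommGroup V] [NormedSpace ℝ V] [FiniteDimensional ℝ V]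
variable {B : LinearMap.BilinForm ℝ V} {L : Submodule ℤ V} {x₀ : V}

/-! ### The plane of an edge -/

omit [FiniteDimensional ℝ V] in
theorem inner_neg_of_mk_ne (hB : IsMinkowski B) (hreg : IsRegular B L x₀) {u v : V}
    (hu : u ∈ chamberCone B L x₀) (hv : v ∈ chamberCone B L x₀)
    (hne : Projectivization.mk ℝ u hu.1 ≠ Projectivization.mk ℝ v hv.1) : B u v < 0 := by
  by_contra! h
  have e := hB.proportional_of_nonneg hreg.1 hu.2.1 hv.2.1 hu.2.2.1 hv.2.2.1 h
  refine hne ((Projectivization.mk_eq_mk_iff' ℝ _ _ _ _).mpr ⟨(B x₀ v)⁻¹ * B x₀ u, ?_⟩)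
  rw [mul_smul, ← e, smul_smul, inv_mul_cancel₀ hv.2.2.1.ne, one_smul]

/-- An end of an edge inside hyperbolic space is an ordinary corner: otherwise the roots vanishing
there would leave room to prolong the edge, or to move off it. -/
theorem isOrdinaryCorner_of_isEdge [DiscreteTopology L] [IsZLattice ℝ L] (hB : IsMinkowski B)
    (hr : ∀ x ∈ L, ∀ y ∈ L, ∃ q : ℚ, B x y = q) (hreg : IsRegular B L x₀) {n : ℕ}
    (hn : finrank ℝ V = n + 1) {u v : V} (hu : u ∈ chamberCone B L x₀)
    (hv : v ∈ chamberCone B L x₀)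
    (hne : Projectivization.mk ℝ u hu.1 ≠ Projectivization.mk ℝ v hv.1)
    (hE : IsEdge B (chamber B L x₀)
      (closedGeodesic B (Projectivization.mk ℝ u hu.1) (Projectivization.mk ℝ v hv.1)))
    (hvv : B v v < 0) :
    IsOrdinaryCorner B L n (chamber B L x₀) (Projectivization.mk ℝ v hv.1) := by
  refine (isOrdinaryCorner_mk_iff hB hn hv).mpr ⟨hvv, fun z hz => ?_⟩
  obtain ⟨ε, hε, ⟨s, t, hs, ht, h1⟩, s', t', hs', ht', h2⟩ :=
    hE.exists_add_smul hB hr hreg hu hv hv hvv (Or.inl (Or.inr rfl)) hz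
  have h3 : (s + s') • u = (2 - (t + t')) • v := by
    have : (v + ε • z) + (v - ε • z) = (s • u + t • v) + (s' • u + t' • v) := by rw [h1, h2]
    rw [sub_smul, add_smul, add_smul, eq_sub_iff_add_eq, two_smul]
    trans (s • u + t • v) + (s' • u + t' • v)
    · module
    · rw [← this]; module
  have h4 : s + s' = 0 := by
    by_contra h
    refine hne ((Projectivization.mk_eq_mk_iff' ℝ _ _ _ _).mpr
      ⟨(s + s')⁻¹ * (2 - (t + t')), ?_⟩)
    rw [mul_smul, ← h3, smul_smul, inv_mul_cancel₀ h, one_smul]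
  have hs0 : s = 0 := by linarith
  rw [hs0, zero_smul, zero_add] at h1
  refine Submodule.mem_span_singleton.mpr ⟨ε⁻¹ * (t - 1), ?_⟩
  rw [mul_smul, sub_smul, ← h1, one_smul, add_sub_cancel_left, smul_smul, inv_mul_cancel₀ hε,
    one_smul]

/-- The roots vanishing on an edge cut out the plane spanned by the edge. -/
theorem exists_eq_of_forall_root [DiscreteTopology L] [IsZLattice ℝ L] (hB : IsMinkowski B)
    (hr : ∀ x ∈ L, ∀ y ∈ L, ∃ q : ℚ, B x y = q) (hreg : IsRegular B L x₀) {u v : V}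
    (hu : u ∈ chamberCone B L x₀) (hv : v ∈ chamberCone B L x₀) (huv : B u v < 0)
    (hE : IsEdge B (chamber B L x₀)
      (closedGeodesic B (Projectivization.mk ℝ u hu.1) (Projectivization.mk ℝ v hv.1)))
    {z : V} (hz : ∀ α ∈ rootSystem B L, B α u = 0 → B α v = 0 → B α z = 0) :
    ∃ a b : ℝ, z = a • u + b • v := by
  have hw := add_mem_chamberCone hB hreg hu hv
  have hww := inner_add_self_neg hB hu hv huv
  have hmem := mk_mem_openGeodesic (s := 1) (t := 1) (B := B) hu.1 hv.1 hw.1 (by module)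
    (by linarith)
  obtain ⟨ε, hε, ⟨s, t, -, -, h⟩, -⟩ :=
    hE.exists_add_smul hB hr hreg hu hv hw hww (Or.inr hmem) fun α hα h0 => by
      obtain ⟨h1, h2⟩ := root_eq_zero_of_add hreg hα hu hv one_pos one_pos (by simpa using h0)
      exact hz α hα h1 h2
  refine ⟨ε⁻¹ * (s - 1), ε⁻¹ * (t - 1), ?_⟩
  have h1 : ε • z = (s - 1) • u + (t - 1) • v := by
    have e : ε • z = (u + v + ε • z) - (u + v) := by abel
    rw [e, h]; module
  have h2 : z = ε⁻¹ • ε • z := by rw [smul_smul, inv_mul_cancel₀ hε, one_smul]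
  rw [h2, h1, smul_add, smul_smul, smul_smul]

omit [FiniteDimensional ℝ V] in
/-- Collinear vectors cannot have negative product if one of them is null. -/
theorem false_of_collinear {u v : V} (huv : B u v < 0) (hvv : B v v = 0) {w : V} {c d : ℝ}
    (hu : u = c • w) (hv : v = d • w) : False := by
  have hd : d ≠ 0 := by
    rintro rfl
    simp [hv] at huv
  have hww : B w w = 0 := by
    rw [hv] at hvv
    simpa [hd] using hvv
  rw [hu, hv] at huv
  simp [hww] at huv

/-- A plane spanned by lattice vectors and containing a null vector `v` carries an endomorphism of
the lattice that is a multiple of the bivector of the plane, and whose square on the plane is an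
integer. -/
theorem exists_integral_bivector [DiscreteTopology L] [IsZLattice ℝ L] (hB : IsMinkowski B)
    (hr : ∀ x ∈ L, ∀ y ∈ L, ∃ q : ℚ, B x y = q) {u v : V} (huv : B u v < 0) (hvv : B v v = 0)
    (hU : ∀ z, (∀ α ∈ rootSystem B L, B α u = 0 → B α v = 0 → B α z = 0) →
      ∃ a b : ℝ, z = a • u + b • v) :
    ∃ (K : V →ₗ[ℝ] V) (κ : ℝ) (D : ℤ), κ ≠ 0 ∧ (∀ x, K x = κ • bivector B u v x) ∧
      (∀ x ∈ L, K x ∈ L) ∧ (D : ℝ) = (κ * B u v) ^ 2 ∧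
      ∃ l ∈ L, ∃ a b : ℝ, l = a • u + b • v ∧ a * B u u + 2 * b * B u v ≠ 0 := by
  set M : Set V := {l | l ∈ L ∧ ∀ α ∈ {α ∈ rootSystem B L | B α u = 0 ∧ B α v = 0}, B α l = 0}
    with hM
  have hMU : ∀ l ∈ M, ∃ a b : ℝ, l = a • u + b • v := fun l hl =>
    hU l fun α hα h1 h2 => hl.2 α ⟨hα, h1, h2⟩
  have hspan : ∀ z, (∀ α ∈ {α ∈ rootSystem B L | B α u = 0 ∧ B α v = 0}, B α z = 0) →
      z ∈ Submodule.span ℝ M := fun z hz =>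
    mem_span_lattice_orthogonal hr (fun α hα => hα.1.1) hz
  have hu := hspan u fun α hα => hα.2.1
  have hv := hspan v fun α hα => hα.2.2
  obtain ⟨u₁, hu₁, u₂, hu₂, a₁, b₁, a₂, b₂, rfl, rfl, hδ⟩ : ∃ u₁ ∈ M, ∃ u₂ ∈ M,
      ∃ a₁ b₁ a₂ b₂ : ℝ, u₁ = a₁ • u + b₁ • v ∧ u₂ = a₂ • u + b₂ • v ∧
        a₁ * b₂ - a₂ * b₁ ≠ 0 := by
    by_contra! hcon
    have h0 : ∃ u₁ ∈ M, u₁ ≠ 0 := by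
      by_contra! h
      rw [Submodule.span_eq_bot.mpr h, Submodule.mem_bot] at hv
      simp [hv] at huv
    obtain ⟨u₁, hu₁, hu₁0⟩ := h0
    obtain ⟨a₁, b₁, e₁⟩ := hMU u₁ hu₁
    have hle : Submodule.span ℝ M ≤ Submodule.span ℝ {u₁} := by
      refine Submodule.span_le.mpr fun l hl => ?_
      obtain ⟨a₂, b₂, e₂⟩ := hMU l hl
      have hd := hcon u₁ hu₁ l hl a₁ b₁ a₂ b₂ e₁ e₂
      refine Submodule.mem_span_singleton.mpr ?_
      by_cases ha : a₁ = 0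
      · have hb : b₁ ≠ 0 := by
          rintro rfl
          exact hu₁0 (by simp [e₁, ha])
        have ha₂ : a₂ = 0 := by simpa [ha, hb] using hd
        refine ⟨b₂ / b₁, ?_⟩
        rw [e₁, e₂, ha, ha₂]
        match_scalars
        · simp
        · field_simp
      · refine ⟨a₂ / a₁, ?_⟩
        rw [e₁, e₂]
        match_scalars
        · field_simp
        · field_simp
          linear_combination -hd
    obtain ⟨c, hc⟩ := Submodule.mem_span_singleton.mp (hle hu)
    obtain ⟨d, hd⟩ := Submodule.mem_span_singleton.mp (hle hv)
    exact false_of_collinear huv hvv hc.symm hd.symm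
  obtain ⟨q, hq, hint⟩ := exists_common_denominator hr
  have hq0 : (q : ℝ) ≠ 0 := by exact_mod_cast hq.ne'
  have huv' : B v u = B u v := hB.symm v u
  set δ := a₁ * b₂ - a₂ * b₁ with hδdef
  refine ⟨(q : ℝ) • bivector B (a₁ • u + b₁ • v) (a₂ • u + b₂ • v), q * δ, ?_⟩
  obtain ⟨m₁₁, h₁₁⟩ := hint _ hu₁.1 _ hu₁.1
  obtain ⟨m₁₂, h₁₂⟩ := hint _ hu₁.1 _ hu₂.1
  obtain ⟨m₂₂, h₂₂⟩ := hint _ hu₂.1 _ hu₂.1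
  refine ⟨m₁₂ ^ 2 - m₁₁ * m₂₂, mul_ne_zero hq0 hδ, fun x => ?_, fun x hx => ?_, ?_, ?_⟩
  · simp only [LinearMap.smul_apply, bivector_apply, map_add, map_smul, LinearMap.add_apply,
      smul_eq_mul, hδdef]
    module
  · obtain ⟨c, hc⟩ := hint _ hu₁.1 x hx
    obtain ⟨d, hd⟩ := hint _ hu₂.1 x hx
    rw [LinearMap.smul_apply, bivector_apply, smul_sub, smul_smul, smul_smul, hc, hd,
      Int.cast_smul_eq_zsmul, Int.cast_smul_eq_zsmul]
    exact L.sub_mem (L.smul_mem _ hu₂.1) (L.smul_mem _ hu₁.1)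
  · push_cast
    rw [← h₁₁, ← h₁₂, ← h₂₂]
    simp only [map_add, map_smul, LinearMap.add_apply, LinearMap.smul_apply, smul_eq_mul, hvv,
      huv', hδdef]
    ring
  · by_contra! h
    have k₁ := h _ hu₁.1 a₁ b₁ rfl
    have k₂ := h _ hu₂.1 a₂ b₂ rfl
    refine hδ (mul_left_cancel₀ (mul_ne_zero two_ne_zero huv.ne) ?_)
    rw [hδdef, mul_zero]
    -- Two vectors killed by one nonzero functional on the plane are dependent.
    by_cases hc : B u u = 0
    · have e1 : b₁ = 0 := by simpa [hc, huv.ne] using k₁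
      have e2 : b₂ = 0 := by simpa [hc, huv.ne] using k₂
      rw [e1, e2]; ring
    · linear_combination a₁ * k₂ - a₂ * k₁

/-! ### Rational ideal ends -/

omit [FiniteDimensional ℝ V] in
theorem forall_exists_abs_le_of_span {S : Set V} {A : Set V}
    (hA : ∀ α ∈ A, ∃ M, ∀ x ∈ S, |B α x| ≤ M) {z : V} (hz : z ∈ Submodule.span ℝ A) :
    ∃ M, ∀ x ∈ S, |B z x| ≤ M := by
  induction hz using Submodule.span_induction with
  | mem z hz => exact hA z hz
  | zero => exact ⟨0, by simp⟩
  | add y z _ _ hy hz =>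
    obtain ⟨M, hM⟩ := hy
    obtain ⟨N, hN⟩ := hz
    refine ⟨M + N, fun x hx => ?_⟩
    rw [map_add, LinearMap.add_apply]
    exact (abs_add_le _ _).trans (add_le_add (hM x hx) (hN x hx))
  | smul c z _ hz =>
    obtain ⟨M, hM⟩ := hz
    refine ⟨|c| * M, fun x hx => ?_⟩
    rw [map_smul, LinearMap.smul_apply, smul_eq_mul, abs_mul]
    exact mul_le_mul_of_nonneg_left (hM x hx) (abs_nonneg _)

/-- The mirrors of the roots vanishing on an edge with a rational ideal end `v` have parallel
translates on both sides. Hence such a root is bounded on the chamber, once the vectors are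
normalized with respect to `v`. -/
theorem exists_abs_le_of_rational [DiscreteTopology L] [IsZLattice ℝ L] (hB : IsMinkowski B)
    (hr : ∀ x ∈ L, ∀ y ∈ L, ∃ q : ℚ, B x y = q) (hreg : IsRegular B L x₀) {u v : V}
    (hu : u ∈ chamberCone B L x₀) (huv : B u v < 0) (hvv : B v v = 0)
    {τ : ℝ} (hτ : τ ≠ 0) (hρ : τ • v ∈ L)
    {α : V} (hα : α ∈ rootSystem B L) (hαu : B α u = 0) (hαv : B α v = 0) :
    ∃ M, ∀ x ∈ chamberCone B L x₀, B v x = -1 → |B α x| ≤ M := by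
  obtain ⟨q, hq, hint⟩ := exists_common_denominator hr
  have hq0 : (0 : ℝ) < q := by exact_mod_cast hq
  have hvα : B v α = 0 := by rw [hB.symm]; exact hαv
  have key : ∀ α ∈ rootSystem B L, B α u = 0 → B α v = 0 → B v α = 0 →
      ∃ c : ℝ, 0 < c ∧ α + c • v ∈ rootSystem B L := by
    intro α hα hαu hαv hvα
    -- The factor `2 q` makes the transvection `1 + K + K² / 2` integral.
    set K := bivector B (τ • v) ((2 * q : ℝ) • α) with hK
    have hKx : ∀ x, K x = (2 * q * τ * B v x) • α - (2 * q * τ * B α x) • v := fun x => by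
      simp only [hK, bivector_apply, map_smul, LinearMap.smul_apply, smul_eq_mul]
      module
    have hKK : ∀ x, K (K x) = (-(4 * q ^ 2 * τ ^ 2 * B α α * B v x)) • v := fun x => by
      rw [hKx (K x), hKx x]
      simp only [map_sub, map_smul, smul_eq_mul, hvα, hαv, hvv]
      module
    obtain ⟨g, hg, hg', hgB⟩ := exists_isometry (K := K) (D := 0) (s := 1) (t := 1 / 2)
      (bivector_skew hB.symm _ _) (fun x => by
        rw [hKK (K x), hKx x]
        simp [hvα, hvv]) (by norm_num)
    have hL : ∀ x ∈ L, K x ∈ L ∧ (1 / 2 : ℝ) • K (K x) ∈ L := by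
      intro x hx
      obtain ⟨m, hm⟩ := hint _ hρ x hx
      obtain ⟨k, hk⟩ := hint α hα.1 x hx
      obtain ⟨j, hj⟩ := hint α hα.1 α hα.1
      rw [map_smul, LinearMap.smul_apply, smul_eq_mul] at hm
      constructor
      · have e : K x = (2 * m : ℤ) • α - (2 * k : ℤ) • (τ • v) := by
          rw [hKx, ← Int.cast_smul_eq_zsmul ℝ, ← Int.cast_smul_eq_zsmul ℝ]
          push_cast
          rw [← hm, ← hk]
          module
        rw [e]
        exact L.sub_mem (L.smul_mem _ hα.1) (L.smul_mem _ hρ)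
      · have e : (1 / 2 : ℝ) • K (K x) = (-(2 * j * m) : ℤ) • (τ • v) := by
          rw [hKK, ← Int.cast_smul_eq_zsmul ℝ]
          push_cast
          rw [← hm, ← hj]
          module
        rw [e]
        exact L.smul_mem _ hρ
    have hgL : ∀ x ∈ L, g x ∈ L := fun x hx => by
      rw [hg, one_smul]; exact L.add_mem (L.add_mem hx (hL x hx).1) (hL x hx).2
    have hgL' : ∀ x ∈ L, g.symm x ∈ L := fun x hx => by
      rw [hg', one_smul]; exact L.add_mem (L.sub_mem hx (hL x hx).1) (hL x hx).2
    have h1 : α + (-(2 * q * τ * B α α)) • v ∈ rootSystem B L := by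
      convert map_mem_rootSystem hgB hgL hgL' hα using 1
      rw [hg, hKK, hKx, hvα]
      module
    have h2 : α + (2 * q * τ * B α α) • v ∈ rootSystem B L := by
      convert map_mem_rootSystem (g := g.symm) (fun x y => by
        rw [← hgB, g.apply_symm_apply, g.apply_symm_apply]) hgL' hgL hα using 1
      rw [hg', hKK, hKx, hvα]
      module
    have hpos : 0 < 2 * q * B α α := mul_pos (mul_pos two_pos hq0) hα.2.1
    rcases lt_or_gt_of_ne hτ with h | h
    · exact ⟨_, by nlinarith, h1⟩
    · exact ⟨_, by nlinarith, h2⟩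
  have key2 : ∀ α ∈ rootSystem B L, B α u = 0 → B α v = 0 → B v α = 0 →
      ∃ c : ℝ, ∀ x ∈ chamberCone B L x₀, B v x = -1 → B α x ≤ c := by
    intro α hα hαu hαv hvα
    obtain ⟨c, hc, hroot⟩ := key α hα hαu hαv hvα
    refine ⟨c, fun x hx hvx => ?_⟩
    have h1 : B (α + c • v) u < 0 := by
      simp only [map_add, map_smul, LinearMap.add_apply, LinearMap.smul_apply, smul_eq_mul, hαu,
        hB.symm v u, zero_add]
      exact mul_neg_of_pos_of_neg hc huv
    have h2 := root_nonpos_of_neg hreg hroot hu hx h1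
    simp only [map_add, map_smul, LinearMap.add_apply, LinearMap.smul_apply, smul_eq_mul,
      hvx] at h2
    linarith
  obtain ⟨c, hc⟩ := key2 α hα hαu hαv hvα
  obtain ⟨c', hc'⟩ := key2 (-α) (neg_mem_rootSystem hα) (by simpa) (by simpa) (by simpa)
  refine ⟨max c c', fun x hx hvx => abs_le.mpr ⟨?_, (hc x hx hvx).trans (le_max_left _ _)⟩⟩
  have := hc' x hx hvx
  simp only [map_neg, LinearMap.neg_apply] at this
  linarith [le_max_right c c']

/-- A rational ideal end `v` of an edge is a corner. The roots vanishing on the edge are bounded on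
the chamber and span the complement of the plane of the edge, so the component of a normalized
vector transverse to this plane is bounded; its norm then bounds the remaining coordinate. -/
theorem isIdealCorner_of_rational [DiscreteTopology L] [IsZLattice ℝ L] (hB : IsMinkowski B)
    (hr : ∀ x ∈ L, ∀ y ∈ L, ∃ q : ℚ, B x y = q) (hreg : IsRegular B L x₀) {u v : V}
    (hu : u ∈ chamberCone B L x₀) (hv : v ∈ chamberCone B L x₀)
    (huv : B u v < 0) (hvv : B v v = 0)
    (hU : ∀ z, (∀ α ∈ rootSystem B L, B α u = 0 → B α v = 0 → B α z = 0) →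
      ∃ a b : ℝ, z = a • u + b • v)
    {τ : ℝ} (hτ : τ ≠ 0) (hρ : τ • v ∈ L) :
    IsIdealCorner B (chamber B L x₀) (Projectivization.mk ℝ v hv.1) := by
  refine isIdealCorner_of_forall_exists_norm_le hB hreg hv hvv fun d hd => ?_
  set A : Set V := {α ∈ rootSystem B L | B α u = 0 ∧ B α v = 0} with hAdef
  have htop : Submodule.span ℝ (A ∪ {u, v}) = ⊤ := by
    have hrefl : B.IsRefl := fun x y h => by rw [hB.symm]; exact h
    rw [← LinearMap.BilinForm.orthogonal_orthogonal hB.nondegenerate hrefl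
      (Submodule.span ℝ (A ∪ {u, v}))]
    have : B.orthogonal (Submodule.span ℝ (A ∪ {u, v})) = ⊥ := by
      rw [eq_bot_iff]
      intro z hz
      have hz' : ∀ y ∈ A ∪ {u, v}, B y z = 0 := fun y hy => hz y (Submodule.subset_span hy)
      obtain ⟨a, b, rfl⟩ := hU z fun α hα h1 h2 => hz' α (Or.inl ⟨hα, h1, h2⟩)
      have h1 := hz' v (Or.inr (Or.inr rfl))
      have h2 := hz' u (Or.inr (Or.inl rfl))
      simp only [map_add, map_smul, smul_eq_mul, hvv, hB.symm v u] at h1 h2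
      have ha : a = 0 := by simpa [huv.ne] using h1
      have hb : b = 0 := by simpa [ha, huv.ne] using h2
      simp [ha, hb]
    rw [this]
    ext z
    simp
  -- A null vector `v'` on the plane of `u` and `v`, dual to `v`.
  obtain ⟨v', hv'v', hvv', a', b', hv'⟩ : ∃ v', B v' v' = 0 ∧ B v v' = -1 ∧
      ∃ a b : ℝ, v' = a • u + b • v := by
    refine ⟨_, ?_, ?_, -(B u v)⁻¹, B u u / (2 * B u v ^ 2), rfl⟩
    all_goals
      have := huv.ne
      simp only [map_add, map_smul, LinearMap.add_apply, LinearMap.smul_apply, smul_eq_mul, hvv,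
        hB.symm v u]
      field_simp
      ring
  have hvlin : ∀ y, B v' y = a' * B u y + b' * B v y := fun y => by simp [hv']
  let r : V → V := fun x => x + B v' x • v + B v x • v'
  have hrapp : ∀ z x, B z (r x) = B z x + B v' x * B z v + B v x * B z v' := fun z x => by
    simp only [r, map_add, map_smul, smul_eq_mul]
  have hv'v : B v' v = -1 := by rw [hB.symm]; exact hvv'
  obtain ⟨R, hR⟩ : ∃ R, ∀ y ∈ r '' {x | x ∈ chamberCone B L x₀ ∧ B v x = -1}, ‖y‖ ≤ R := by
    refine hB.exists_norm_le_of_forall fun z => forall_exists_abs_le_of_span (A := A ∪ {u, v}) ?_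
      (htop ▸ Submodule.mem_top)
    have hrv : ∀ x, B v (r x) = 0 := fun x => by rw [hrapp, hvv, hvv']; ring
    have hrv' : ∀ x, B v' (r x) = 0 := fun x => by rw [hrapp, hv'v', hv'v]; ring
    rintro α (⟨hα, hαu, hαv⟩ | rfl | rfl)
    · obtain ⟨M, hM⟩ := exists_abs_le_of_rational hB hr hreg hu huv hvv hτ hρ hα hαu hαv
      refine ⟨M, ?_⟩
      rintro _ ⟨x, ⟨hx, hvx⟩, rfl⟩
      have hαv' : B α v' = 0 := by rw [hv', map_add, map_smul, map_smul, hαu, hαv]; simp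
      rw [hrapp, hαv, hαv']
      simpa using hM x hx hvx
    · refine ⟨0, ?_⟩
      rintro _ ⟨x, -, rfl⟩
      have h1 : a' * B α (r x) + b' * B v (r x) = 0 := by
        rw [← hrv' x]; simp [hvlin]
      rw [hrv, mul_zero, add_zero] at h1
      rcases mul_eq_zero.mp h1 with h | h
      · rw [hv', h, zero_smul, zero_add, map_smul, hvv, smul_zero] at hvv'
        norm_num at hvv'
      · simp [h]
    · refine ⟨0, ?_⟩
      rintro _ ⟨x, -, rfl⟩
      simp [hrv]
  obtain ⟨N, hN⟩ := (isCompact_closedBall (0 : V) R).exists_bound_of_continuousOn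
    (continuous_form_self B).continuousOn
  refine ⟨R + (d + N) * ‖v‖ + ‖v'‖, fun x hx hvx hxx => ?_⟩
  have h1 := hR (r x) ⟨x, ⟨hx, hvx⟩, rfl⟩
  have h2 : |B (r x) (r x)| ≤ N := hN (r x) (by simpa using h1)
  have h3 : B (r x) (r x) = -d - 2 * B v' x := by
    rw [hB.symm, hrapp, hB.symm (r x) x, hrapp, hB.symm (r x) v, hrapp, hB.symm (r x) v', hrapp,
      hvv, hvv', hv'v, hv'v', hxx, hvx, hB.symm x v, hB.symm x v', hvx]
    ring
  have h4 : |B v' x| ≤ d + N := by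
    rw [h3] at h2
    have := abs_le.mp h2
    exact abs_le.mpr ⟨by linarith, by linarith⟩
  have h5 : x = r x - B v' x • v + v' := by
    simp only [r, hvx]; module
  calc ‖x‖ = ‖r x - B v' x • v + v'‖ := by rw [← h5]
    _ ≤ ‖r x‖ + ‖B v' x • v‖ + ‖v'‖ :=
      (norm_add_le _ _).trans (add_le_add_left (norm_sub_le _ _) _)
    _ ≤ R + (d + N) * ‖v‖ + ‖v'‖ := by
      rw [norm_smul, Real.norm_eq_abs]
      gcongr

end Edge

section Irrational

variable {V : Type*} [NormedAddCommGroup V] [NormedSpace ℝ V]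
variable {B : LinearMap.BilinForm ℝ V} {L : Submodule ℤ V} {x₀ : V}

/-! ### Irrational ideal ends -/

/-- Pell's equation provides a hyperbolic translation of the lattice along the plane of `u` and
`v`, in either direction: the sign of `S` can be prescribed. -/
theorem exists_pell_isometry (hB : IsMinkowski B) {u v : V} (huv : B u v < 0) (hvv : B v v = 0)
    {K : V →ₗ[ℝ] V} {κ : ℝ} {D : ℤ} (hκ : κ ≠ 0) (hK : ∀ x, K x = κ • bivector B u v x)
    (hKL : ∀ x ∈ L, K x ∈ L) (hD : (D : ℝ) = (κ * B u v) ^ 2) (hsq : ¬IsSquare D)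
    {σ : ℝ} (hσ : σ ≠ 0) :
    ∃ (g : V ≃ₗ[ℝ] V) (S lam : ℝ), 0 < S * σ ∧ 0 < lam ∧
      lam - lam⁻¹ = 2 * S * (κ * B u v) ∧
      (∀ x y, B (g x) (g y) = B x y) ∧
      (∀ α ∈ rootSystem B L, g α ∈ rootSystem B L) ∧
      (∀ α ∈ rootSystem B L, g.symm α ∈ rootSystem B L) ∧
      (∀ x, B x u = 0 → B x v = 0 → g x = x) ∧
      g v = lam • v ∧ g u = lam⁻¹ • u + (S * κ * B u u) • v := by
  have hμ : κ * B u v ≠ 0 := mul_ne_zero hκ huv.ne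
  have hDpos : 0 < D := by
    have : (0 : ℝ) < D := by rw [hD]; exact sq_pos_of_ne_zero hμ
    exact_mod_cast this
  -- With `Z² - D Y² = 1`, the map `1 + 2 Z Y K + 2 Y² K²` is the square of `Z + Y K` on the plane.
  obtain ⟨X, Y, hXY, hY⟩ := Pell.exists_of_not_isSquare hDpos hsq
  have hX : X ≠ 0 := by
    rintro rfl
    nlinarith [mul_nonneg hDpos.le (sq_nonneg Y)]
  obtain ⟨Z, hZ, hZσ⟩ : ∃ Z : ℤ, Z ^ 2 - D * Y ^ 2 = 1 ∧ (0 : ℝ) < (2 * Z * Y : ℤ) * σ := by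
    have hne : ((2 * X * Y : ℤ) : ℝ) * σ ≠ 0 :=
      mul_ne_zero (by exact_mod_cast mul_ne_zero (mul_ne_zero two_ne_zero hX) hY) hσ
    rcases lt_or_gt_of_ne hne with h | h
    · refine ⟨-X, by rw [neg_sq]; exact hXY, ?_⟩
      push_cast at h ⊢
      linarith
    · exact ⟨X, hXY, h⟩
  set S : ℝ := ((2 * Z * Y : ℤ) : ℝ) with hS
  set T : ℝ := ((2 * Y ^ 2 : ℤ) : ℝ) with hT
  have hTpos : 0 < T := by
    have : 0 < 2 * Y ^ 2 := by positivity
    rw [hT]; exact_mod_cast this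
  have hST : S ^ 2 = 2 * T + D * T ^ 2 := by
    rw [hS, hT]
    have : (2 * Z * Y) ^ 2 = 2 * (2 * Y ^ 2) + D * (2 * Y ^ 2) ^ 2 := by
      linear_combination 4 * Y ^ 2 * hZ
    exact_mod_cast this
  have hKKK : ∀ x, K (K (K x)) = (D : ℝ) • K x := fun x => by
    simp only [hK, map_smul, bivector_bivector_bivector hB.symm, hvv, hD]
    module
  have hskew : ∀ x y, B (K x) y = -B x (K y) := fun x y => by
    simp only [hK, map_smul, LinearMap.smul_apply, bivector_skew hB.symm, smul_neg]
  obtain ⟨g, hg, hg', hgB⟩ := exists_isometry hskew hKKK hST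
  have hgL : ∀ x ∈ L, g x ∈ L := fun x hx => by
    rw [hg, hS, hT, Int.cast_smul_eq_zsmul, Int.cast_smul_eq_zsmul]
    exact L.add_mem (L.add_mem hx (L.smul_mem _ (hKL x hx))) (L.smul_mem _ (hKL _ (hKL x hx)))
  have hgL' : ∀ x ∈ L, g.symm x ∈ L := fun x hx => by
    rw [hg', hS, hT, Int.cast_smul_eq_zsmul, Int.cast_smul_eq_zsmul]
    exact L.add_mem (L.sub_mem hx (L.smul_mem _ (hKL x hx))) (L.smul_mem _ (hKL _ (hKL x hx)))
  have hKv : K v = (κ * B u v) • v := by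
    rw [hK, bivector_apply, hvv]; module
  have hKu : K u = (κ * B u u) • v - (κ * B u v) • u := by
    rw [hK, bivector_apply, hB.symm v u]; module
  set μ := κ * B u v with hμdef
  have hprod : (1 + S * μ + T * μ ^ 2) * (1 - S * μ + T * μ ^ 2) = 1 := by
    rw [hD] at hST
    linear_combination -μ ^ 2 * hST
  have hsum : 0 < (1 + S * μ + T * μ ^ 2) + (1 - S * μ + T * μ ^ 2) := by
    nlinarith [mul_nonneg hTpos.le (sq_nonneg μ)]
  have hpos : 0 < 1 + S * μ + T * μ ^ 2 := by
    by_contra! h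
    nlinarith
  have hinv : (1 + S * μ + T * μ ^ 2)⁻¹ = 1 - S * μ + T * μ ^ 2 :=
    inv_eq_of_mul_eq_one_right hprod
  refine ⟨g, S, 1 + S * μ + T * μ ^ 2, hZσ, hpos, ?_, hgB,
    fun α hα => map_mem_rootSystem hgB hgL hgL' hα,
    fun α hα => map_mem_rootSystem (g := g.symm) (fun x y => by
      rw [← hgB, g.apply_symm_apply, g.apply_symm_apply]) hgL' hgL hα, ?_, ?_, ?_⟩
  · rw [hinv]; ring
  · intro x hxu hxv
    have hKx : K x = 0 := by
      rw [hK, bivector_apply, hB.symm u x, hB.symm v x, hxu, hxv]; simp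
    rw [hg, hKx]; simp
  · rw [hg, hKv, map_smul, hKv]; module
  · rw [hg, hinv, hKu, map_sub, map_smul, map_smul, hKv, hKu]; module

/-- An isometry permuting the roots, scaling `u` and `v` and fixing the roots orthogonal to both,
preserves the chamber of the edge from `u` to `v`. -/
theorem map_mem_chamberCone (hB : IsMinkowski B) (hreg : IsRegular B L x₀) {u v : V}
    (hu : u ∈ chamberCone B L x₀) (hv : v ∈ chamberCone B L x₀)
    (huv : B u v < 0) {g : V ≃ₗ[ℝ] V} (hg : ∀ x y, B (g x) (g y) = B x y)
    (hroot : ∀ α ∈ rootSystem B L, g.symm α ∈ rootSystem B L)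
    (hfix : ∀ α, B α u = 0 → B α v = 0 → g α = α) {a b : ℝ} (ha : 0 < a) (hb : 0 < b)
    (hgu : g u = a • u) (hgv : g v = b • v) {x : V} (hx : x ∈ chamberCone B L x₀) :
    g x ∈ chamberCone B L x₀ := by
  have hsymm : ∀ y z, B (g.symm y) z = B y (g z) := fun y z => by
    rw [← hg, g.apply_symm_apply]
  have hne : g x ≠ 0 := fun h => hx.1 (g.map_eq_zero_iff.mp h)
  have hle : B (g x) (g x) ≤ 0 := by rw [hg]; exact hx.2.1
  have hgux : B u (g x) ≤ 0 := by
    have h1 := inner_nonpos_of_mem hB hreg hu hx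
    rw [← hg, hgu, map_smul, LinearMap.smul_apply, smul_eq_mul] at h1
    exact nonpos_of_mul_nonpos_right h1 ha
  have hgvx : B v (g x) ≤ 0 := by
    have h1 := inner_nonpos_of_mem hB hreg hv hx
    rw [← hg, hgv, map_smul, LinearMap.smul_apply, smul_eq_mul] at h1
    exact nonpos_of_mul_nonpos_right h1 hb
  refine ⟨hne, hle, ?_, fun α hα hαx => ?_⟩
  · by_contra! h
    have h0 : 0 < B x₀ (g x) := h.lt_of_ne' (hB.inner_ne_zero hreg.1 hle hne)
    have huv' := add_mem_chamberCone hB hreg hu hv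
    have hneg := inner_add_self_neg hB hu hv huv
    have := hB.inner_neg_of_timelike (y := -g x) hreg.1 hneg (by simpa using hle) huv'.2.2.1
      (by simpa using h0)
    simp only [map_neg, map_add, LinearMap.add_apply] at this
    linarith
  · have hα' := hroot α hα
    rw [← hsymm]
    have h1 := hu.2.2.2 α hα hαx
    have h2 := hv.2.2.2 α hα hαx
    rcases h1.lt_or_eq with h1 | h1
    · refine root_nonneg_of_pos hreg hα' hu hx ?_
      rw [hsymm, hgu, map_smul]; exact mul_pos ha h1
    rcases h2.lt_or_eq with h2 | h2
    · refine root_nonneg_of_pos hreg hα' hv hx ?_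
      rw [hsymm, hgv, map_smul]; exact mul_pos hb h2
    have : g.symm α = α := by
      rw [LinearEquiv.symm_apply_eq, hfix α h1.symm h2.symm]
    rw [this]
    exact hx.2.2.2 α hα hαx

/-- The powers of a translation along the edge, described by what they do to the products with its
ends. -/
theorem exists_zpow_mem_chamberCone (hB : IsMinkowski B) (hreg : IsRegular B L x₀) {u v : V}
    (hu : u ∈ chamberCone B L x₀) (hv : v ∈ chamberCone B L x₀)
    (huv : B u v < 0) {g : V ≃ₗ[ℝ] V} (hg : ∀ x y, B (g x) (g y) = B x y)
    (hroot : ∀ α ∈ rootSystem B L, g α ∈ rootSystem B L)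
    (hroot' : ∀ α ∈ rootSystem B L, g.symm α ∈ rootSystem B L)
    (hfix : ∀ α, B α u = 0 → B α v = 0 → g α = α) {lam : ℝ} (hlam : 0 < lam)
    (hgu : g u = lam⁻¹ • u) (hgv : g v = lam • v) {x : V} (hx : x ∈ chamberCone B L x₀) (m : ℤ) :
    ∃ y ∈ chamberCone B L x₀, B y y = B x x ∧ B u y = lam ^ m * B u x ∧
      B v y = lam ^ (-m) * B v x := by
  have hl0 := hlam.ne'
  have hinv := inv_pos.mpr hlam
  have hgu' : g.symm u = lam • u := by
    rw [LinearEquiv.symm_apply_eq, map_smul, hgu, smul_smul, mul_inv_cancel₀ hl0, one_smul]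
  have hgv' : g.symm v = lam⁻¹ • v := by
    rw [LinearEquiv.symm_apply_eq, map_smul, hgv, smul_smul, inv_mul_cancel₀ hl0, one_smul]
  have hg' : ∀ x y, B (g.symm x) (g.symm y) = B x y := fun x y => by
    rw [← hg, g.apply_symm_apply, g.apply_symm_apply]
  have hfix' : ∀ α, B α u = 0 → B α v = 0 → g.symm α = α := fun α h1 h2 => by
    rw [LinearEquiv.symm_apply_eq, hfix α h1 h2]
  induction m using Int.induction_on with
  | zero => exact ⟨x, hx, rfl, by simp, by simp⟩
  | succ m ih =>
    obtain ⟨y, hy, h1, h2, h3⟩ := ih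
    refine ⟨g y, map_mem_chamberCone hB hreg hu hv huv hg hroot' hfix hinv hlam hgu hgv hy,
      by rw [hg, h1], ?_, ?_⟩
    · have : B (g.symm u) (g.symm (g y)) = lam * B u y := by
        rw [hgu', g.symm_apply_apply, map_smul]; rfl
      rw [← hg', this, h2, zpow_add_one₀ hl0]; ring
    · have : B (g.symm v) (g.symm (g y)) = lam⁻¹ * B v y := by
        rw [hgv', g.symm_apply_apply, map_smul]; rfl
      rw [← hg', this, h3, neg_add, ← sub_eq_add_neg, zpow_sub_one₀ hl0]; ring
  | pred m ih =>
    obtain ⟨y, hy, h1, h2, h3⟩ := ih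
    refine ⟨g.symm y, map_mem_chamberCone (g := g.symm) hB hreg hu hv huv hg' hroot hfix' hlam
      hinv hgu' hgv' hy, by rw [hg', h1], ?_, ?_⟩
    · have : B (g u) (g (g.symm y)) = lam⁻¹ * B u y := by
        rw [hgu, g.apply_symm_apply, map_smul]; rfl
      rw [← hg, this, h2, zpow_sub_one₀ hl0]; ring
    · have : B (g v) (g (g.symm y)) = lam * B v y := by
        rw [hgv, g.apply_symm_apply, map_smul]; rfl
      have e : -(-(m : ℤ) - 1) = -(-(m : ℤ)) + 1 := by ring
      rw [← hg, this, h3, e, zpow_add_one₀ hl0]; ring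

variable [FiniteDimensional ℝ V]

/-- A translation along an edge with two ideal ends carries the compactness of horospherical
sections from one end to the other. -/
theorem isIdealCorner_of_translation (hB : IsMinkowski B) (hreg : IsRegular B L x₀) {u v : V}
    (hu : u ∈ chamberCone B L x₀) (hv : v ∈ chamberCone B L x₀)
    (huv : B u v < 0) (huu : B u u = 0) (hvv : B v v = 0)
    (hcorner : IsIdealCorner B (chamber B L x₀) (Projectivization.mk ℝ u hu.1))
    {g : V ≃ₗ[ℝ] V} (hg : ∀ x y, B (g x) (g y) = B x y)
    (hroot : ∀ α ∈ rootSystem B L, g α ∈ rootSystem B L)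
    (hroot' : ∀ α ∈ rootSystem B L, g.symm α ∈ rootSystem B L)
    (hfix : ∀ α, B α u = 0 → B α v = 0 → g α = α) {lam : ℝ} (hlam : 1 < lam)
    (hgu : g u = lam⁻¹ • u) (hgv : g v = lam • v) :
    IsIdealCorner B (chamber B L x₀) (Projectivization.mk ℝ v hv.1) := by
  have hlam0 : 0 < lam := one_pos.trans hlam
  refine isIdealCorner_of_forall_exists_norm_le hB hreg hv hvv fun d hd => ?_
  obtain ⟨R, hR⟩ := hcorner.exists_norm_le hB hu.1 hd
  set M := ‖LinearMap.toContinuousLinearMap (B v)‖ * R with hM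
  have hpp := inner_add_self_neg hB hu hv huv
  obtain ⟨R', hR'⟩ := hB.exists_norm_le hpp 0 (lam * (M * lam) + 1)
  refine ⟨R', fun x hx hvx hxx => hR' x hx.2.1 ?_⟩
  have hux : B u x < 0 := by
    rw [hB.symm]
    exact hB.inner_neg_of_timelike hreg.1 (by linarith) hu.2.1 hx.2.2.1 hu.2.2.1
  -- Translate `x` so that its product with `u` becomes comparable to `-1`.
  obtain ⟨k, hk1, hk2⟩ := exists_mem_Ico_zpow (neg_pos.mpr hux) hlam
  obtain ⟨y, hy, hyy, huy, hvy⟩ := exists_zpow_mem_chamberCone hB hreg hu hv huv hg hroot hroot'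
    hfix hlam0 hgu hgv hx (-k)
  have hP : 0 < lam ^ k := zpow_pos hlam0 k
  rw [zpow_neg] at huy
  rw [neg_neg, hvx] at hvy
  set b := (lam ^ k)⁻¹ * -B u x with hb
  have hb1 : 1 ≤ b := by
    rw [hb, inv_mul_eq_div, one_le_div hP]; exact hk1
  have hb2 : b ≤ lam := by
    rw [hb, inv_mul_eq_div, div_le_iff₀ hP, mul_comm, ← zpow_add_one₀ hlam0.ne']; exact hk2.le
  have hb0 : 0 < b := one_pos.trans_le hb1
  have huy' : B u y = -b := by rw [huy, hb]; ring
  -- Move along `u` to reach the horosphere on which the bound `R` is available.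
  set c := (d - d / b ^ 2) / 2 with hc
  have hc0 : 0 ≤ c := by
    have : d / b ^ 2 ≤ d := div_le_self hd.le (one_le_pow₀ hb1)
    rw [hc]; linarith
  have hz : b⁻¹ • y + c • u ∈ chamberCone B L x₀ := by
    have hy' := smul_mem_chamberCone hy (inv_pos.mpr hb0)
    rcases hc0.lt_or_eq with h | h
    · exact add_mem_chamberCone hB hreg hy' (smul_mem_chamberCone hu h)
    · rwa [← h, zero_smul, add_zero]
  have hzR := hR _ hz
    (by simp only [map_add, map_smul, smul_eq_mul, huy', huu]; field_simp; simp)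
    (by
      simp only [map_add, map_smul, LinearMap.add_apply, LinearMap.smul_apply, smul_eq_mul, huy',
        huu, hB.symm y u, hyy, hxx, hc]
      field_simp
      ring)
  have hvz : -B v (b⁻¹ • y + c • u) ≤ M := by
    refine (neg_le_abs _).trans (((LinearMap.toContinuousLinearMap (B v)).le_opNorm _).trans ?_)
    exact mul_le_mul_of_nonneg_left hzR (norm_nonneg _)
  have h1 : lam ^ k ≤ M * b := by
    rw [map_add, map_smul, map_smul, smul_eq_mul, smul_eq_mul, hvy, hB.symm v u] at hvz
    have h2 : b⁻¹ * lam ^ k ≤ M := by nlinarith [mul_nonneg hc0 (neg_nonneg.mpr huv.le)]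
    rwa [inv_mul_eq_div, div_le_iff₀ hb0] at h2
  have hM0 : 0 ≤ M := nonneg_of_mul_nonneg_left (hP.le.trans h1) hb0
  have h2 : -B u x ≤ lam * (M * lam) := by
    have e : -B u x = b * lam ^ k := by rw [hb]; field_simp
    rw [e]
    exact mul_le_mul hb2 (h1.trans (mul_le_mul_of_nonneg_left hb2 hM0)) hP.le hlam0.le
  rw [map_add, LinearMap.add_apply, hvx, abs_le]
  constructor <;> linarith

/-- No edge leads from an ordinary corner to an irrational ideal point: a translation along the edge
would move the mirrors that end the edge at its corner into its interior. -/
theorem false_of_translation (hB : IsMinkowski B) (hreg : IsRegular B L x₀) {n : ℕ}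
    (hn : finrank ℝ V = n + 1) {u v : V}
    (hu : u ∈ chamberCone B L x₀) (hv : v ∈ chamberCone B L x₀)
    (huv : B u v < 0) (hvv : B v v = 0)
    (hcorner : IsOrdinaryCorner B L n (chamber B L x₀) (Projectivization.mk ℝ u hu.1))
    {g : V ≃ₗ[ℝ] V} (hg : ∀ x y, B (g x) (g y) = B x y)
    (hroot : ∀ α ∈ rootSystem B L, g α ∈ rootSystem B L) {lam t : ℝ} (hlam : 0 < lam) (ht : 0 < t)
    (hgu : g u = lam⁻¹ • u + t • v) (hgv : g v = lam • v) : False := by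
  obtain ⟨-, h⟩ := (isOrdinaryCorner_mk_iff hB hn hu).mp hcorner
  have hβ : ∃ β ∈ rootSystem B L, B β u = 0 ∧ 0 < B β v := by
    by_contra! hcon
    obtain ⟨c, hc⟩ := Submodule.mem_span_singleton.mp (h v fun α hα hαu => by
      have h1 := hcon α hα hαu
      have h2 := hcon (-α) (neg_mem_rootSystem hα) (by simpa using hαu)
      simp only [map_neg, LinearMap.neg_apply] at h2
      linarith)
    exact false_of_collinear huv hvv (one_smul ℝ u).symm hc.symm
  obtain ⟨β, hβ, hβu, hβv⟩ := hβ
  have h1 : 0 < B (g β) v := by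
    rw [← hg, hgv, map_smul, smul_eq_mul] at hβv
    exact pos_of_mul_pos_right hβv hlam.le
  have h2 : 0 ≤ B (g β) u := root_nonneg_of_pos hreg (hroot β hβ) hv hu h1
  rw [← hg, hgu, map_add, map_smul, map_smul, smul_eq_mul, smul_eq_mul] at hβu
  nlinarith [mul_pos ht h1, mul_nonneg (inv_pos.mpr hlam).le h2]

/-! ### Edges end at corners -/

/-- The passage from a corner `u` of the chamber along an edge to its other end `v`. The ideal ends
are separated by whether the plane of the edge is isotropic over the rationals. -/
theorem isCorner_of_isEdge [DiscreteTopology L] [IsZLattice ℝ L] (hB : IsMinkowski B)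
    (hr : ∀ x ∈ L, ∀ y ∈ L, ∃ q : ℚ, B x y = q) (hreg : IsRegular B L x₀) {n : ℕ}
    (hn : finrank ℝ V = n + 1) {u v : V} (hu : u ∈ chamberCone B L x₀)
    (hv : v ∈ chamberCone B L x₀)
    (hne : Projectivization.mk ℝ u hu.1 ≠ Projectivization.mk ℝ v hv.1)
    (hE : IsEdge B (chamber B L x₀)
      (closedGeodesic B (Projectivization.mk ℝ u hu.1) (Projectivization.mk ℝ v hv.1)))
    (hcorner : IsCorner B L n (chamber B L x₀) (Projectivization.mk ℝ u hu.1)) :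
    IsCorner B L n (chamber B L x₀) (Projectivization.mk ℝ v hv.1) := by
  rcases hv.2.1.lt_or_eq with hvv | hvv
  · exact Or.inl (isOrdinaryCorner_of_isEdge hB hr hreg hn hu hv hne hE hvv)
  refine Or.inr ?_
  have huv := inner_neg_of_mk_ne hB hreg hu hv hne
  have hU := fun z => exists_eq_of_forall_root hB hr hreg hu hv huv hE (z := z)
  obtain ⟨K, κ, D, hκ, hK, hKL, hD, l, hl, a, b, rfl, hlne⟩ :=
    exists_integral_bivector hB hr huv hvv hU
  have hμ : κ * B u v ≠ 0 := mul_ne_zero hκ huv.ne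
  by_cases hsq : IsSquare D
  · obtain ⟨s, rfl⟩ := hsq
    obtain ⟨m, hm⟩ : ∃ m : ℤ, (m : ℝ) = κ * B u v := by
      have : (s : ℝ) ^ 2 = (κ * B u v) ^ 2 := by rw [← hD]; push_cast; ring
      rcases sq_eq_sq_iff_eq_or_eq_neg.mp this with h | h
      · exact ⟨s, h⟩
      · exact ⟨-s, by push_cast; rw [h, neg_neg]⟩
    refine isIdealCorner_of_rational hB hr hreg hu hv huv hvv hU (mul_ne_zero hκ hlne) ?_
    -- The eigenvector of `K` in the direction of `v`, obtained by applying `K + μ`.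
    have e : (κ * (a * B u u + 2 * b * B u v)) • v =
        K (a • u + b • v) + m • (a • u + b • v) := by
      rw [← Int.cast_smul_eq_zsmul ℝ, hm, hK, bivector_apply]
      simp only [map_add, map_smul, smul_eq_mul, hvv, hB.symm v u]
      module
    rw [e]
    exact L.add_mem (hKL _ hl) (L.smul_mem _ hl)
  · rcases hcorner with hcorner | hcorner
    · exfalso
      have huu := ((isOrdinaryCorner_mk_iff hB hn hu).mp hcorner).1
      obtain ⟨g, S, lam, hS, hlam, -, hg, hroot, -, -, hgv, hgu⟩ :=
        exists_pell_isometry hB huv hvv hκ hK hKL hD hsq (mul_ne_zero hκ huu.ne)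
      exact false_of_translation hB hreg hn hu hv huv hvv hcorner hg hroot hlam
        (by linarith : 0 < S * κ * B u u) hgu hgv
    · have huu := mk_mem_idealBoundary.mp hcorner.2.1
      obtain ⟨g, S, lam, hS, hlam, hlam', hg, hroot, hroot', hfix, hgv, hgu⟩ :=
        exists_pell_isometry hB huv hvv hκ hK hKL hD hsq hμ
      have h1 : 1 < lam := by
        by_contra! h
        have := one_le_inv_iff₀.mpr ⟨hlam, h⟩
        nlinarith
      rw [huu, mul_zero, zero_smul, add_zero] at hgu
      exact isIdealCorner_of_translation hB hreg hu hv huv huu hvv hcorner hg hroot hroot' hfix h1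
        hgu hgv

/-- A point strictly inside a geodesic of the chamber is not a corner: it is timelike, and the roots
vanishing there vanish on the whole geodesic. -/
theorem not_isCorner_of_mem_interior (hB : IsMinkowski B) (hreg : IsRegular B L x₀) {n : ℕ}
    (hn : finrank ℝ V = n + 1) {u v : V} (hu : u ∈ chamberCone B L x₀)
    (hv : v ∈ chamberCone B L x₀)
    (hne : Projectivization.mk ℝ u hu.1 ≠ Projectivization.mk ℝ v hv.1) {s t : ℝ} (hs : 0 < s)
    (ht : 0 < t) (hw : s • u + t • v ≠ 0) :
    ¬IsCorner B L n (chamber B L x₀) (Projectivization.mk ℝ (s • u + t • v) hw) := by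
  have huv := inner_neg_of_mk_ne hB hreg hu hv hne
  have hwm := add_mem_chamberCone hB hreg (smul_mem_chamberCone hu hs) (smul_mem_chamberCone hv ht)
  rintro (h | h)
  · obtain ⟨-, h⟩ := (isOrdinaryCorner_mk_iff hB hn hwm).mp h
    obtain ⟨c, hc⟩ := Submodule.mem_span_singleton.mp (h u fun α hα h0 =>
      (root_eq_zero_of_add hreg hα hu hv hs ht h0).1)
    obtain ⟨d, hd⟩ := Submodule.mem_span_singleton.mp (h v fun α hα h0 =>
      (root_eq_zero_of_add hreg hα hu hv hs ht h0).2)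
    have hd0 : d ≠ 0 := fun h => hv.1 (by rw [← hd, h, zero_smul])
    refine hne ((Projectivization.mk_eq_mk_iff' ℝ _ _ _ _).mpr ⟨c * d⁻¹, ?_⟩)
    calc (c * d⁻¹) • v = (c * d⁻¹) • d • (s • u + t • v) := by rw [hd]
      _ = c • (s • u + t • v) := by rw [smul_smul, mul_assoc, inv_mul_cancel₀ hd0, mul_one]
      _ = u := hc
  · have h0 := mk_mem_idealBoundary.mp h.2.1
    have e : B (s • u + t • v) (s • u + t • v) =
        s ^ 2 * B u u + t ^ 2 * B v v + 2 * (s * t) * B u v := by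
      simp [hB.symm v u]; ring
    rw [e] at h0
    nlinarith [mul_nonpos_of_nonneg_of_nonpos (sq_nonneg s) hu.2.1,
      mul_nonpos_of_nonneg_of_nonpos (sq_nonneg t) hv.2.1,
      mul_neg_of_pos_of_neg (mul_pos hs ht) huv]

end Irrational

end LorentzianLattice

open LorentzianLattice in
theorem mainTheorem10 {V : Type*} [NormedAddCommGroup V] [NormedSpace ℝ V]
    [FiniteDimensional ℝ V] (B : LinearMap.BilinForm ℝ V)
    (L : Submodule ℤ V) [DiscreteTopology L] [IsZLattice ℝ L] (n : ℕ)
    (hL : LorentzianLattice.IsLorentzian B L n)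
    (C : Set (Projectivization ℝ V)) (hC : LorentzianLattice.IsWeylChamber B L C)
    (k : Projectivization ℝ V) (hk : LorentzianLattice.IsCorner B L n C k)
    (e : Set (Projectivization ℝ V)) (he : LorentzianLattice.IsEdge B C e) (hke : k ∈ e) :
    (∃ k', LorentzianLattice.IsOtherEnd B e k k') ∧
      ∀ k', LorentzianLattice.IsOtherEnd B e k k' → LorentzianLattice.IsCorner B L n C k' := by
  have hB := hL.signature.isMinkowski
  have hn := hL.signature.finrank_eq
  obtain ⟨x₀, hreg, rfl⟩ := hC.exists_eq_chamber hB
  constructor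
  · obtain ⟨⟨a, b, hab, rfl⟩, hsub, -⟩ := id he
    obtain ⟨u, hu0, hu, rfl⟩ := hsub (Or.inl (Or.inl rfl))
    obtain ⟨v, hv0, hv, rfl⟩ := hsub (Or.inl (Or.inr rfl))
    obtain ⟨w, hw0, hw, rfl⟩ := hsub hke
    obtain ⟨s, t, hs, ht, rfl⟩ := exists_of_mk_mem_closedGeodesic hB hreg hu hv hw hke
    rcases hs.lt_or_eq with hs | rfl
    · rcases ht.lt_or_eq with ht | rfl
      · exact absurd hk (not_isCorner_of_mem_interior hB hreg hn hu hv hab hs ht hw0)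
      · have hw' : Projectivization.mk ℝ (s • u + (0 : ℝ) • v) hw0 = Projectivization.mk ℝ u hu0 :=
          (Projectivization.mk_eq_mk_iff' ℝ _ _ _ _).mpr ⟨s, by simp⟩
        rw [hw']
        exact ⟨_, hab.symm, rfl⟩
    · have hw' : Projectivization.mk ℝ ((0 : ℝ) • u + t • v) hw0 = Projectivization.mk ℝ v hv0 :=
        (Projectivization.mk_eq_mk_iff' ℝ _ _ _ _).mpr ⟨t, by simp⟩
      rw [hw']
      exact ⟨_, hab, closedGeodesic_comm hB.symm _ _⟩
  · rintro k' ⟨hne, rfl⟩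
    obtain ⟨u, hu0, hu, rfl⟩ := he.2.1 (Or.inl (Or.inl rfl))
    obtain ⟨v, hv0, hv, rfl⟩ := he.2.1 (Or.inl (Or.inr rfl))
    exact isCorner_of_isEdge hB hL.rational hreg hn hu hv hne.symm he hk
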